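/- For a smooth function $f>0$ on $[a,b]$ ($a<b$; by translation one may take $a=0$), consider the rotationally symmetric metric $g=f(t)^2(dt^2+d\theta^2)$ on the cylinder $[a,b]\times\mathbb S^1$, $\theta\in\mathbb R/2\pi\mathbb Z$. For a metric $g$ on the cylinder $\Sigma=[a,b]\times\mathbb S^1$ let $0=\sigma_0(g)<\sigma_1(g)\le\sigma_2(g)\le\cdots$ be its Steklov eigenvalues, i.e. the eigenvalues, repeated according to multiplicity, of the Dirichlet-to-Neumann map, which sends a smooth function on $\partial\Sigma$ to the outward unit normal derivative of its $g$-harmonic extension; the normalized $k$-th Steklov eigenvalue is $\tilde\sigma_k(g)=\sigma_k(g)\,L_g(\partial\Sigma)$, where $L_g(\partial\Sigma)$ is the length of the boundary. Let $$X(t,\theta)=(2\sinh t\cos\theta,\;2\sinh t\sin\theta,\;\cosh 2t\cos 2\theta,\;\cosh 2t\sin 2\theta)\in\mathbb R^4 .$$ **Theorem.** The equation $2\tanh s=\coth(s/2)$ has a unique positive root $T=T_{2,1}(1)$. The surface $X$ is a Möbius band: $X(s,\theta)=X(t,\eta)$ if and only if either $s=t$ and $\theta\equiv\eta$, or $s=-t$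 and $\theta\equiv\eta+\pi$ modulo $2\pi$. For $s>0$, the part $-s\le t\le s$ of $X$ lies in a ball centred at the origin, with its interior $|t|<s$ in the open ball, its boundary on the bounding sphere and meeting that sphere orthogonally, if and only if $s=T/2$; the part $-T/2\le t\le T/2$ is called the critical Möbius band. The metric that $X$ induces on the cylinder $[-T/2,T/2]\times\mathbb S^1$ from the Euclidean metric of $\mathbb R^4$ is of the form $f(t)^2(dt^2+d\theta^2)$ with $f$ smooth and positive, and its normalized fourth Steklov eigenvalue $\tilde\sigma_4$ is the maximum of $\tilde\sigma_4(g)$ over all rotationally symmetric metrics $g=f(t)^2(dt^2+d\theta^2)$ on all cylinders $[a,b]\times\mathbb S^1$. -/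

import Mathlib

open scoped ContDiff

namespace Steklov

/-! The cylinder `[a, b] × S¹` is described in coordinates `(t, θ)` with `t ∈ [a, b]` and `θ` taken
modulo `2π`: functions on it are functions on `[a, b] × ℝ` that are `2π`-periodic in `θ`, and a
metric is given by its matrix of components, index `0` standing for `t` and index `1` for `θ`. -/

noncomputable section

/-- The components of a metric in the coordinates `(t, θ)`. -/
abbrev MetricComponents := ℝ × ℝ → Matrix (Fin 2) (Fin 2) ℝ

/-- The partial derivatives `∂u/∂t` (index `0`, one-sided at the two ends of `[a, b]`) and `∂u/∂θ`
(index `1`) of a function on `[a, b] × ℝ`. -/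
def partialDeriv (a b : ℝ) (u : ℝ × ℝ → ℝ) (i : Fin 2) (p : ℝ × ℝ) : ℝ :=
  if i = 0 then derivWithin (fun s => u (s, p.2)) (Set.Icc a b) p.1
  else deriv (fun η => u (p.1, η)) p.2

/-- The components `g^{ij} ∂_j u` of the gradient of `u` with respect to `g`. -/
def gradient (a b : ℝ) (g : MetricComponents) (u : ℝ × ℝ → ℝ) (i : Fin 2) (p : ℝ × ℝ) : ℝ :=
  ∑ j, (g p)⁻¹ i j * partialDeriv a b u j p

/-- The Laplace-Beltrami operator `(det g)^{-1/2} ∂_i ((det g)^{1/2} g^{ij} ∂_j u)`. -/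
def laplacian (a b : ℝ) (g : MetricComponents) (u : ℝ × ℝ → ℝ) (p : ℝ × ℝ) : ℝ :=
  (Real.sqrt (g p).det)⁻¹ *
    ∑ i, partialDeriv a b (fun q => Real.sqrt (g q).det * gradient a b g u i q) i p

/-- `⟨∇t / |∇t|, ∇u⟩`, the derivative of `u` along the unit normal of the circles `t = const` that
points in the direction of increasing `t`. -/
def normalDeriv (a b : ℝ) (g : MetricComponents) (u : ℝ × ℝ → ℝ) (p : ℝ × ℝ) : ℝ :=
  gradient a b g u 0 p / Real.sqrt ((g p)⁻¹ 0 0)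

/-- Functions on the boundary of the cylinder: one function of `θ` on the circle `t = a` (first
component) and one on the circle `t = b` (second component). -/
abbrev BoundaryFunction := (ℝ → ℝ) × (ℝ → ℝ)

/-- `u` is a function on the cylinder that is smooth up to the boundary, harmonic for `g`, and has
boundary values `φ`. (In particular the components of `φ` are smooth and `2π`-periodic.) -/
structure IsHarmonicExtension (a b : ℝ) (g : MetricComponents) (φ : BoundaryFunction)
    (u : ℝ × ℝ → ℝ) : Prop where
  smooth : ContDiffOn ℝ ∞ u (Set.Icc a b ×ˢ Set.univ)
  periodic : ∀ t ∈ Set.Icc a b, ∀ θ, u (t, θ + 2 * Real.pi) = u (t, θ)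
  harmonic : ∀ t ∈ Set.Ioo a b, ∀ θ, laplacian a b g u (t, θ) = 0
  left_value : ∀ θ, u (a, θ) = φ.1 θ
  right_value : ∀ θ, u (b, θ) = φ.2 θ

/-- The graph of the Dirichlet-to-Neumann map: `ψ` is the derivative of the harmonic extension of
`φ` along the outward unit normal of the boundary. -/
def IsDirichletToNeumann (a b : ℝ) (g : MetricComponents) (φ ψ : BoundaryFunction) : Prop :=
  ∃ u, IsHarmonicExtension a b g φ u ∧
    (∀ θ, ψ.1 θ = -normalDeriv a b g u (a, θ)) ∧ (∀ θ, ψ.2 θ = normalDeriv a b g u (b, θ))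

/-- The `k`-th eigenvalue `σ_k`, `k = 0, 1, 2, …`, of the Dirichlet-to-Neumann map, repeated
according to multiplicity: the least `σ` for which there are `k + 1` linearly independent
eigenfunctions whose eigenvalues are at most `σ`. -/
def steklovEigenvalue (a b : ℝ) (g : MetricComponents) (k : ℕ) : ℝ :=
  sInf {σ : ℝ | ∃ φ : Fin (k + 1) → BoundaryFunction, LinearIndependent ℝ φ ∧
    ∀ i, ∃ s ≤ σ, IsDirichletToNeumann a b g (φ i) (s • φ i)}

/-- The total length of the two boundary circles. -/
def boundaryLength (a b : ℝ) (g : MetricComponents) : ℝ :=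
  (∫ θ in (0 : ℝ)..(2 * Real.pi), Real.sqrt (g (a, θ) 1 1)) +
    ∫ θ in (0 : ℝ)..(2 * Real.pi), Real.sqrt (g (b, θ) 1 1)

/-- The normalized Steklov eigenvalue `σ_k(g) L_g(∂Σ)`. -/
def normalizedSteklovEigenvalue (a b : ℝ) (g : MetricComponents) (k : ℕ) : ℝ :=
  steklovEigenvalue a b g k * boundaryLength a b g

/-- The metric `f(t)² (dt² + dθ²)`. -/
def rotationalMetric (f : ℝ → ℝ) : MetricComponents :=
  fun p => (f p.1 ^ 2) • (1 : Matrix (Fin 2) (Fin 2) ℝ)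

/-- `f` is an admissible factor on `[a, b]`: smooth up to the ends, and positive. -/
def IsConformalFactor (a b : ℝ) (f : ℝ → ℝ) : Prop :=
  ContDiffOn ℝ ∞ f (Set.Icc a b) ∧ ∀ t ∈ Set.Icc a b, 0 < f t

/-- The tangent vectors `X_t` (index `0`) and `X_θ` (index `1`) of a parametrized surface. -/
def tangentVector (X : ℝ × ℝ → EuclideanSpace ℝ (Fin 4)) (i : Fin 2) (p : ℝ × ℝ) :
    EuclideanSpace ℝ (Fin 4) :=
  if i = 0 then deriv (fun s => X (s, p.2)) p.1 else deriv (fun η => X (p.1, η)) p.2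

/-- The metric induced by the Euclidean metric of `ℝ⁴` on a parametrized surface. -/
def inducedMetric (X : ℝ × ℝ → EuclideanSpace ℝ (Fin 4)) : MetricComponents :=
  fun p => Matrix.of fun i j => inner ℝ (tangentVector X i p) (tangentVector X j p)

/-- The part `t ∈ [a, b]` of the surface `X` lies in a ball centred at the origin, its interior in
the open ball and its boundary on the bounding sphere, and along its boundary it meets that sphere
orthogonally: the normal direction of the sphere, that of the position vector, is tangent to the
surface. -/
def MeetsSphereOrthogonally (a b : ℝ) (X : ℝ × ℝ → EuclideanSpace ℝ (Fin 4)) : Prop :=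
  ∃ R > 0, (∀ t ∈ Set.Ioo a b, ∀ θ, ‖X (t, θ)‖ < R) ∧
    ∀ t, (t = a ∨ t = b) → ∀ θ, ‖X (t, θ)‖ = R ∧
      X (t, θ) ∈ Submodule.span ℝ {tangentVector X 0 (t, θ), tangentVector X 1 (t, θ)}

/-- The parametrization of the (unbounded) Möbius band in `ℝ⁴`. -/
def moebius (p : ℝ × ℝ) : EuclideanSpace ℝ (Fin 4) :=
  !₂[2 * Real.sinh p.1 * Real.cos p.2, 2 * Real.sinh p.1 * Real.sin p.2,
    Real.cosh (2 * p.1) * Real.cos (2 * p.2), Real.cosh (2 * p.1) * Real.sin (2 * p.2)]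

/-- `T` is the number `T_{k,1}(1)`: the unique positive root of `k tanh (k s / 2) = coth (s / 2)`. -/
def IsUniqueCrossing (k : ℕ) (T : ℝ) : Prop :=
  (0 < T ∧ k * Real.tanh (k * T / 2) = Real.cosh (T / 2) / Real.sinh (T / 2)) ∧
    ∀ s, 0 < s → k * Real.tanh (k * s / 2) = Real.cosh (s / 2) / Real.sinh (s / 2) → s = T

end

end Steklov

namespace Steklov

/-! In dimension two, `f(t)²(dt² + dθ²)` has the harmonic functions of the flat cylinder, and its
normal derivative is `± u_t / f`. So only `x = f a`, `y = f b` and `L = b - a` enter the Steklov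
problem. Separation of variables splits it into 2×2 blocks: for frequency `n ≥ 1`, each of the
cosine and sine modes has as eigenvalues the roots of `Q n s = x y s² - n coth(n L) (x + y) s + n²`.

Upper bound. Put `M = 2√3 / (x + y)`. Together with the constants, five independent eigenfunctions
with eigenvalue at most `M` are always available. If `Q 1 M > 0`, both roots of `Q 1` lie below `M`,
and each counts twice. Otherwise `coth_inequality` gives `Q 2 M ≤ 0`, so `Q 2` has a root in `[0,
M]`, which joins the smaller root of `Q 1`. Hence `σ₄ ≤ M`; the length is `2π(x + y)`, so the
normalized value is at most `4π√3` for every metric (`exists_five_eigenfunctions`).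

Equality. The equation for `T` says `cosh T = 2`. On `[-h, h]` with `h = T/2` and equal boundary
weights, blocks split by parity, with eigenvalues `n coth(n h) / f h` (odd) and `n tanh(n h) / f h`
(even). The odd ones with `n ≥ 1` and the even ones with `n ≥ 2` are all at least `√3 / f h`; the
choice of `h` makes `coth h = 2 tanh 2h = √3`. Below this level only the two modes with `n = 0` and
the even modes with `n = 1` can occur, a space of dimension at most four
(`not_linearIndependent_of_lt`), so `σ₄ = √3 / f h`.

The induced metric of the Möbius band is conformal with an even factor, and orthogonality to the
sphere amounts to `cosh 2s = 2`, that is `s = T/2`. -/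

/-! ### The number `T`: the equation `cosh T = 2` -/

/-- Half-angle formulas turn the equation into `4 sinh²(s/2) = cosh s`, where the left side is `2
(cosh s - 1)`. -/
theorem two_mul_tanh_eq_coth_iff {s : ℝ} (hs : 0 < s) :
    ((2 : ℕ) : ℝ) * Real.tanh ((2 : ℕ) * s / 2) = Real.cosh (s / 2) / Real.sinh (s / 2) ↔
      Real.cosh s = 2 := by
  have h1 : 0 < Real.sinh (s / 2) := Real.sinh_pos_iff.2 (by linarith)
  have h2 : 0 < Real.cosh s := Real.cosh_pos s
  have h3 : 0 < Real.cosh (s / 2) := Real.cosh_pos _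
  have e : ((2 : ℕ) : ℝ) * s / 2 = s := by push_cast; ring
  rw [e, Real.tanh_eq_sinh_div_cosh, mul_div_assoc', div_eq_div_iff h2.ne' h1.ne']
  have hc : Real.cosh s = 1 + 2 * Real.sinh (s / 2) ^ 2 := by
    have := Real.cosh_two_mul (s / 2)
    rw [show 2 * (s / 2) = s by ring, Real.cosh_sq] at this
    linarith
  have hsn : Real.sinh s = 2 * Real.sinh (s / 2) * Real.cosh (s / 2) := by
    rw [← Real.sinh_two_mul]; congr 1; ring
  rw [hsn]
  push_cast
  constructor
  · intro h
    have : (4 * Real.sinh (s / 2) ^ 2) = Real.cosh s := by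
      apply mul_left_cancel₀ h3.ne'
      linarith
    linarith
  · intro h
    have : 4 * Real.sinh (s / 2) ^ 2 = Real.cosh s := by linarith
    rw [← this]; ring

theorem eq_of_cosh_eq {s t : ℝ} (hs : 0 < s) (ht : 0 < t) (h : Real.cosh s = Real.cosh t) :
    s = t :=
  Real.cosh_strictMonoOn.injOn (Set.mem_Ici.2 hs.le) (Set.mem_Ici.2 ht.le) h

theorem exists_cosh_eq_two : ∃ T : ℝ, 0 < T ∧ Real.cosh T = 2 := by
  refine ⟨Real.arcosh 2, Real.arcosh_pos (by norm_num), Real.cosh_arcosh (by norm_num)⟩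

theorem isUniqueCrossing_of_cosh_eq_two {T : ℝ} (hT : 0 < T) (h : Real.cosh T = 2) :
    IsUniqueCrossing 2 T :=
  ⟨⟨hT, (two_mul_tanh_eq_coth_iff hT).2 h⟩, fun s hs hs' =>
    eq_of_cosh_eq hs hT (by rw [(two_mul_tanh_eq_coth_iff hs).1 hs', h])⟩

/-! ### Geometry of the Möbius band -/

theorem euclidean_four_eq_iff (a b c d a' b' c' d' : ℝ) :
    (!₂[a, b, c, d] : EuclideanSpace ℝ (Fin 4)) = !₂[a', b', c', d'] ↔
      a = a' ∧ b = b' ∧ c = c' ∧ d = d' := by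
  constructor
  · intro h
    have h0 := congrArg (fun v => v 0) h
    have h1 := congrArg (fun v => v 1) h
    have h2 := congrArg (fun v => v 2) h
    have h3 := congrArg (fun v => v 3) h
    simp at h0 h1 h2 h3
    exact ⟨h0, h1, h2, h3⟩
  · rintro ⟨rfl, rfl, rfl, rfl⟩; rfl

theorem inner_euclidean_four (a b c d a' b' c' d' : ℝ) :
    inner ℝ (!₂[a, b, c, d] : EuclideanSpace ℝ (Fin 4)) !₂[a', b', c', d'] =
      a * a' + b * b' + c * c' + d * d' := by
  rw [PiLp.inner_apply, Fin.sum_univ_four]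
  simp
  ring

theorem exists_int_of_cos_eq_of_sin_eq {x y : ℝ} (hc : Real.cos x = Real.cos y)
    (hs : Real.sin x = Real.sin y) : ∃ n : ℤ, x = y + 2 * Real.pi * n := by
  have h : Real.cos (x - y) = 1 := by
    rw [Real.cos_sub, hc, hs]; nlinarith [Real.sin_sq_add_cos_sq y]
  obtain ⟨n, hn⟩ := (Real.cos_eq_one_iff _).1 h
  exact ⟨n, by linarith⟩

/-- The last two coordinates determine `cosh 2t`, hence `|t|`, and `θ` modulo `π`; the first two tie
the remaining ambiguity in `θ` to the sign of `t`. -/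
theorem moebius_eq_iff (s t θ η : ℝ) : moebius (s, θ) = moebius (t, η) ↔
    (s = t ∧ ∃ n : ℤ, θ = η + 2 * Real.pi * n) ∨
      (s = -t ∧ ∃ n : ℤ, θ = η + Real.pi + 2 * Real.pi * n) := by
  unfold moebius
  rw [euclidean_four_eq_iff]
  have cosn : ∀ (x : ℝ) (n : ℤ), Real.cos (x + 2 * Real.pi * n) = Real.cos x := fun x n => by
    rw [mul_comm (2 * Real.pi)]; exact Real.cos_add_int_mul_two_pi x n
  have sinn : ∀ (x : ℝ) (n : ℤ), Real.sin (x + 2 * Real.pi * n) = Real.sin x := fun x n => by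
    rw [mul_comm (2 * Real.pi)]; exact Real.sin_add_int_mul_two_pi x n
  constructor
  · rintro ⟨h1, h2, h3, h4⟩
    dsimp only at h1 h2 h3 h4
    have hs : 0 < Real.cosh (2 * s) := Real.cosh_pos _
    have ht : 0 < Real.cosh (2 * t) := Real.cosh_pos _
    have hcosh : Real.cosh (2 * s) = Real.cosh (2 * t) := by
      have : Real.cosh (2 * s) ^ 2 = Real.cosh (2 * t) ^ 2 := by
        have e1 := Real.sin_sq_add_cos_sq (2 * θ)
        have e2 := Real.sin_sq_add_cos_sq (2 * η)
        calc Real.cosh (2 * s) ^ 2 = (Real.cosh (2 * s) * Real.cos (2 * θ)) ^ 2 +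
              (Real.cosh (2 * s) * Real.sin (2 * θ)) ^ 2 := by
              linear_combination (-Real.cosh (2 * s) ^ 2) * e1
          _ = (Real.cosh (2 * t) * Real.cos (2 * η)) ^ 2 +
              (Real.cosh (2 * t) * Real.sin (2 * η)) ^ 2 := by rw [h3, h4]
          _ = Real.cosh (2 * t) ^ 2 := by linear_combination (Real.cosh (2 * t) ^ 2) * e2
      exact (sq_eq_sq₀ hs.le ht.le).1 this
    rw [hcosh] at h3 h4
    have h3' := mul_left_cancel₀ ht.ne' h3
    have h4' := mul_left_cancel₀ ht.ne' h4
    have hst : s = t ∨ s = -t := by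
      have habs : |2 * s| = |2 * t| :=
        Real.cosh_strictMonoOn.injOn (Set.mem_Ici.2 (abs_nonneg _)) (Set.mem_Ici.2 (abs_nonneg _))
          (by rw [Real.cosh_abs, Real.cosh_abs, hcosh])
      rcases abs_eq_abs.1 habs with h | h
      · left; linarith
      · right; linarith
    -- On the core circle the first two coordinates vanish, so only `2θ` is known modulo `2π`; the
    -- parity of `n` selects the alternative.
    by_cases hz : t = 0
    · obtain ⟨n, hn⟩ := exists_int_of_cos_eq_of_sin_eq h3' h4'
      have hs0 : s = 0 := by rcases hst with h | h <;> simp [h, hz]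
      rcases Int.even_or_odd' n with ⟨k, hk | hk⟩
      · left; refine ⟨by rw [hs0, hz], k, ?_⟩
        rw [hk] at hn; push_cast at hn; linarith
      · right; refine ⟨by rw [hs0, hz]; simp, k, ?_⟩
        rw [hk] at hn; push_cast at hn; linarith
    · have hsinh : 2 * Real.sinh t ≠ 0 := by simpa using hz
      rcases hst with h | h
      · left
        rw [h] at h1 h2
        exact ⟨h, exists_int_of_cos_eq_of_sin_eq (mul_left_cancel₀ hsinh h1)
          (mul_left_cancel₀ hsinh h2)⟩
      · right
        rw [h, Real.sinh_neg] at h1 h2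
        refine ⟨h, exists_int_of_cos_eq_of_sin_eq (mul_left_cancel₀ hsinh ?_)
          (mul_left_cancel₀ hsinh ?_)⟩
        · rw [Real.cos_add_pi]; linarith
        · rw [Real.sin_add_pi]; linarith
  · rintro (⟨rfl, n, rfl⟩ | ⟨rfl, n, rfl⟩)
    · have e : 2 * (η + 2 * Real.pi * n) = 2 * η + 2 * Real.pi * ((2 * n : ℤ) : ℝ) := by
        push_cast; ring
      simp only [e, cosn, sinn, and_self]
    · have e : 2 * (η + Real.pi + 2 * Real.pi * n) =
          2 * η + 2 * Real.pi * ((2 * n + 1 : ℤ) : ℝ) := by push_cast; ring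
      simp only [e, cosn, sinn, Real.cos_add_pi, Real.sin_add_pi, Real.sinh_neg, mul_neg,
        Real.cosh_neg, neg_mul, neg_neg, and_self]

theorem hasDerivAt_euclidean_four {a b c d : ℝ → ℝ} {a' b' c' d' t : ℝ} (ha : HasDerivAt a a' t)
    (hb : HasDerivAt b b' t) (hc : HasDerivAt c c' t) (hd : HasDerivAt d d' t) :
    HasDerivAt (fun s => (!₂[a s, b s, c s, d s] : EuclideanSpace ℝ (Fin 4)))
      !₂[a', b', c', d'] t := by
  have h : HasDerivAt (fun s => ![a s, b s, c s, d s]) ![a', b', c', d'] t := by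
    rw [hasDerivAt_pi]
    intro i
    fin_cases i <;> simpa
  exact (PiLp.continuousLinearEquiv 2 ℝ fun _ : Fin 4 => ℝ).symm.toContinuousLinearMap.hasFDerivAt
    |>.comp_hasDerivAt t h

theorem tangentVector_moebius_zero (t θ : ℝ) : tangentVector moebius 0 (t, θ) =
    !₂[2 * Real.cosh t * Real.cos θ, 2 * Real.cosh t * Real.sin θ,
      2 * Real.sinh (2 * t) * Real.cos (2 * θ), 2 * Real.sinh (2 * t) * Real.sin (2 * θ)] := by
  simp only [tangentVector, if_true, moebius]
  have h1 := ((Real.hasDerivAt_sinh t).const_mul 2)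
  have h2 : HasDerivAt (fun s => Real.cosh (2 * s)) (2 * Real.sinh (2 * t)) t := by
    simpa [mul_comm] using ((hasDerivAt_id t).const_mul 2).cosh
  exact (hasDerivAt_euclidean_four (h1.mul_const _) (h1.mul_const _) (h2.mul_const _)
    (h2.mul_const _)).deriv

theorem tangentVector_moebius_one (t θ : ℝ) : tangentVector moebius 1 (t, θ) =
    !₂[-(2 * Real.sinh t * Real.sin θ), 2 * Real.sinh t * Real.cos θ,
      -(2 * Real.cosh (2 * t) * Real.sin (2 * θ)), 2 * Real.cosh (2 * t) * Real.cos (2 * θ)] := by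
  simp only [tangentVector, one_ne_zero, if_false, moebius]
  have h3 : HasDerivAt (fun s => Real.cosh (2 * t) * Real.cos (2 * s))
      (-(2 * Real.cosh (2 * t) * Real.sin (2 * θ))) θ := by
    exact ((((hasDerivAt_id' θ).const_mul 2).cos).const_mul (Real.cosh (2 * t))).congr_deriv
      (by ring)
  have h4 : HasDerivAt (fun s => Real.cosh (2 * t) * Real.sin (2 * s))
      (2 * Real.cosh (2 * t) * Real.cos (2 * θ)) θ := by
    exact ((((hasDerivAt_id' θ).const_mul 2).sin).const_mul (Real.cosh (2 * t))).congr_deriv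
      (by ring)
  have h1 := (Real.hasDerivAt_cos θ).const_mul (2 * Real.sinh t)
  rw [mul_neg] at h1
  exact (hasDerivAt_euclidean_four h1 ((Real.hasDerivAt_sin θ).const_mul _) h3 h4).deriv

theorem norm_moebius_sq (t θ : ℝ) :
    ‖moebius (t, θ)‖ ^ 2 = 4 * Real.sinh t ^ 2 + Real.cosh (2 * t) ^ 2 := by
  rw [EuclideanSpace.norm_sq_eq]
  simp only [moebius, Fin.sum_univ_four, Real.norm_eq_abs, sq_abs]
  simp
  have e1 := Real.sin_sq_add_cos_sq θ
  have e2 := Real.sin_sq_add_cos_sq (2 * θ)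
  linear_combination 4 * Real.sinh t ^ 2 * e1 + Real.cosh (2 * t) ^ 2 * e2

theorem norm_moebius_lt {s t : ℝ} (h : |t| < |s|) (θ η : ℝ) :
    ‖moebius (t, θ)‖ < ‖moebius (s, η)‖ := by
  refine lt_of_pow_lt_pow_left₀ 2 (norm_nonneg _) ?_
  rw [norm_moebius_sq, norm_moebius_sq]
  have h2 : Real.cosh (2 * t) < Real.cosh (2 * s) := by
    rw [Real.cosh_lt_cosh, abs_mul, abs_mul]; simpa using h
  have e1 := Real.cosh_two_mul t
  have e2 := Real.cosh_two_mul s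
  rw [Real.cosh_sq] at e1 e2
  have := Real.cosh_pos (2 * t)
  nlinarith

theorem norm_moebius_eq {s t : ℝ} (h : |t| = |s|) (θ η : ℝ) :
    ‖moebius (t, θ)‖ = ‖moebius (s, η)‖ := by
  refine (sq_eq_sq₀ (norm_nonneg _) (norm_nonneg _)).1 ?_
  rw [norm_moebius_sq, norm_moebius_sq]
  rcases abs_eq_abs.1 h with rfl | rfl <;> simp

/-- The position vector must be `tanh t` times `X_t`. The frequency-two coordinates then require
`cosh 2t = 2 tanh t sinh 2t = 4 sinh² t = 2 cosh 2t - 2`. -/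
theorem meetsSphereOrthogonally_moebius_iff {s : ℝ} (hs : 0 < s) :
    MeetsSphereOrthogonally (-s) s moebius ↔ Real.cosh (2 * s) = 2 := by
  have e1 : Real.cosh (2 * s) = 1 + 2 * Real.sinh s ^ 2 := by
    rw [Real.cosh_two_mul, Real.cosh_sq]; ring
  constructor
  · rintro ⟨R, hR, -, h⟩
    -- At `θ = 0` coordinates 0 and 2 of `X_θ` vanish, so these two coordinates involve `α` only.
    obtain ⟨-, h⟩ := h s (Or.inr rfl) 0
    rw [Submodule.mem_span_pair] at h
    obtain ⟨α, β, h⟩ := h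
    rw [tangentVector_moebius_zero, tangentVector_moebius_one] at h
    have h0 := congrArg (fun v => v 0) h
    have h2 := congrArg (fun v => v 2) h
    simp [moebius] at h0 h2
    have e2 := Real.sinh_two_mul s
    have hp : 0 < Real.sinh s := Real.sinh_pos_iff.2 hs
    have : Real.cosh (2 * s) = 4 * Real.sinh s ^ 2 := by
      rw [← h2, e2]; linear_combination (2 * Real.sinh s) * h0
    linarith
  · intro h
    refine ⟨‖moebius (s, 0)‖, ?_, ?_, ?_⟩
    · refine norm_pos_iff.2 fun h0 => ?_
      have := norm_moebius_sq s 0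
      rw [h0, h, norm_zero] at this
      nlinarith [sq_nonneg (Real.sinh s)]
    · intro t ht θ
      exact norm_moebius_lt (by rw [abs_of_pos hs]; exact abs_lt.2 ht) _ _
    · intro t ht θ
      refine ⟨norm_moebius_eq (by rcases ht with rfl | rfl <;> simp) _ _, ?_⟩
      rw [Submodule.mem_span_pair]
      refine ⟨Real.tanh t, 0, ?_⟩
      have hc : Real.cosh t ≠ 0 := (Real.cosh_pos t).ne'
      have ht1 : Real.tanh t * Real.cosh t = Real.sinh t := by
        rw [Real.tanh_eq_sinh_div_cosh]; field_simp
      have h2 : Real.cosh (2 * t) = 2 := by rcases ht with rfl | rfl <;> simpa using h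
      have ht2 : Real.tanh t * (2 * Real.sinh (2 * t)) = Real.cosh (2 * t) := by
        have : Real.cosh (2 * t) = 1 + 2 * Real.sinh t ^ 2 := by
          rw [Real.cosh_two_mul, Real.cosh_sq]; ring
        rw [Real.sinh_two_mul]
        linear_combination 4 * Real.sinh t * ht1 + (-2) * this + h2
      rw [tangentVector_moebius_zero, zero_smul, add_zero, moebius]
      ext i
      fin_cases i <;> simp
      · linear_combination (2 * Real.cos θ) * ht1
      · linear_combination (2 * Real.sin θ) * ht1
      · linear_combination (Real.cos (2 * θ)) * ht2
      · linear_combination (Real.sin (2 * θ)) * ht2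

/-- The conformal factor of the metric induced on the Möbius band. -/
noncomputable def moebiusFactor (t : ℝ) : ℝ :=
  Real.sqrt (4 * Real.cosh t ^ 2 + 4 * Real.sinh (2 * t) ^ 2)

theorem moebiusFactor_radicand_pos (t : ℝ) :
    0 < 4 * Real.cosh t ^ 2 + 4 * Real.sinh (2 * t) ^ 2 := by
  have := Real.cosh_pos t
  positivity

theorem isConformalFactor_moebiusFactor (a b : ℝ) : IsConformalFactor a b moebiusFactor := by
  refine ⟨ContDiff.contDiffOn ?_, fun t _ => Real.sqrt_pos.2 (moebiusFactor_radicand_pos t)⟩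
  refine ContDiff.sqrt ?_ fun t => (moebiusFactor_radicand_pos t).ne'
  have h1 : ContDiff ℝ ∞ Real.cosh := Real.contDiff_cosh
  have h2 : ContDiff ℝ ∞ (fun t : ℝ => Real.sinh (2 * t)) :=
    Real.contDiff_sinh.comp (contDiff_const.mul contDiff_id)
  exact (contDiff_const.mul (h1.pow 2)).add (contDiff_const.mul (h2.pow 2))

theorem moebiusFactor_neg (t : ℝ) : moebiusFactor (-t) = moebiusFactor t := by
  simp [moebiusFactor]

theorem inducedMetric_moebius (p : ℝ × ℝ) :
    inducedMetric moebius p = rotationalMetric moebiusFactor p := by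
  obtain ⟨t, θ⟩ := p
  have e1 := Real.sin_sq_add_cos_sq θ
  have e2 := Real.sin_sq_add_cos_sq (2 * θ)
  have e3 := Real.cosh_sq t
  have e4 := Real.cosh_sq (2 * t)
  ext i j
  simp only [inducedMetric, rotationalMetric, moebiusFactor,
    Real.sq_sqrt (moebiusFactor_radicand_pos t).le, Matrix.of_apply, Matrix.smul_apply]
  fin_cases i <;> fin_cases j <;>
    simp only [Fin.zero_eta, Fin.mk_one, tangentVector_moebius_zero, tangentVector_moebius_one,
      inner_euclidean_four, Matrix.one_apply, if_true, zero_ne_one, one_ne_zero, if_false,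
      smul_eq_mul, mul_one, mul_zero]
  · linear_combination (4 * Real.cosh t ^ 2) * e1 + (4 * Real.sinh (2 * t) ^ 2) * e2
  · ring
  · ring
  · linear_combination (4 * Real.sinh t ^ 2) * e1 + (4 * Real.cosh (2 * t) ^ 2) * e2 -
      4 * e3 + 4 * e4

/-! ### Partial derivatives up to the boundary of the strip -/

/-- The coordinate directions of the cylinder: `0` stands for `t` and `1` for `θ`. -/
def coordVec (i : Fin 2) : ℝ × ℝ := if i = 0 then (1, 0) else (0, 1)

theorem uniqueDiffOn_strip {a b : ℝ} (hab : a < b) :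
    UniqueDiffOn ℝ (Set.Icc a b ×ˢ (Set.univ : Set ℝ)) :=
  (uniqueDiffOn_Icc hab).prod uniqueDiffOn_univ

theorem partialDeriv_eq_fderivWithin {a b : ℝ} (hab : a < b) {v : ℝ × ℝ → ℝ} {t θ : ℝ}
    (ht : t ∈ Set.Icc a b)
    (hv : DifferentiableWithinAt ℝ v (Set.Icc a b ×ˢ Set.univ) (t, θ)) (i : Fin 2) :
    partialDeriv a b v i (t, θ) =
      fderivWithin ℝ v (Set.Icc a b ×ˢ Set.univ) (t, θ) (coordVec i) := by
  have h := hv.hasFDerivWithinAt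
  fin_cases i
  · have h1 : HasDerivWithinAt (fun s : ℝ => ((s, θ) : ℝ × ℝ)) (1, 0) (Set.Icc a b) t :=
      (hasDerivWithinAt_id t _).prodMk (hasDerivWithinAt_const t _ θ)
    have h2 := h.comp_hasDerivWithinAt t h1
      (fun s hs => Set.mk_mem_prod hs (Set.mem_univ θ))
    simpa [partialDeriv, coordVec, Function.comp_def] using h2.derivWithin (uniqueDiffOn_Icc hab t ht)
  · have h1 : HasDerivWithinAt (fun η : ℝ => ((t, η) : ℝ × ℝ)) (0, 1) Set.univ θ :=
      (hasDerivWithinAt_const θ _ t).prodMk (hasDerivWithinAt_id θ _)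
    have h2 := h.comp_hasDerivWithinAt θ h1
      (fun s _ => Set.mk_mem_prod ht (Set.mem_univ s))
    simpa [partialDeriv, coordVec, Function.comp_def] using (hasDerivWithinAt_univ.1 h2).deriv

theorem partialDeriv_congr {a b : ℝ} {v v' : ℝ × ℝ → ℝ}
    (h : ∀ t ∈ Set.Icc a b, ∀ θ, v (t, θ) = v' (t, θ)) (i : Fin 2) {t : ℝ}
    (ht : t ∈ Set.Icc a b) (θ : ℝ) :
    partialDeriv a b v i (t, θ) = partialDeriv a b v' i (t, θ) := by
  unfold partialDeriv
  split_ifs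
  · exact derivWithin_congr (fun s hs => h s hs θ) (h t ht θ)
  · simp only [h t ht]

theorem contDiffOn_partialDeriv {a b : ℝ} (hab : a < b) {v : ℝ × ℝ → ℝ}
    (hv : ContDiffOn ℝ ∞ v (Set.Icc a b ×ˢ Set.univ)) (i : Fin 2) :
    ContDiffOn ℝ ∞ (partialDeriv a b v i) (Set.Icc a b ×ˢ Set.univ) := by
  have h : ContDiffOn ℝ ∞ (fun p => fderivWithin ℝ v (Set.Icc a b ×ˢ Set.univ) p (coordVec i))
      (Set.Icc a b ×ˢ Set.univ) :=
    (hv.fderivWithin (uniqueDiffOn_strip hab) (by simp)).clm_apply contDiffOn_const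
  refine h.congr fun p hp => ?_
  exact partialDeriv_eq_fderivWithin hab hp.1 (hv.differentiableOn (by simp) p hp) i

theorem strip_mem_nhds {a b t : ℝ} (ht : t ∈ Set.Ioo a b) (θ : ℝ) :
    Set.Icc a b ×ˢ (Set.univ : Set ℝ) ∈ nhds (t, θ) :=
  prod_mem_nhds (Icc_mem_nhds ht.1 ht.2) Filter.univ_mem

theorem hasFDerivAt_of_mem_Ioo {a b : ℝ} {v : ℝ × ℝ → ℝ}
    (hv : ContDiffOn ℝ ∞ v (Set.Icc a b ×ˢ Set.univ)) {t : ℝ} (ht : t ∈ Set.Ioo a b) (θ : ℝ) :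
    HasFDerivAt v (fderiv ℝ v (t, θ)) (t, θ) :=
  ((hv.contDiffAt (strip_mem_nhds ht θ)).differentiableAt (by simp)).hasFDerivAt

theorem fderiv_coordVec {a b : ℝ} (hab : a < b) {v : ℝ × ℝ → ℝ}
    (hv : ContDiffOn ℝ ∞ v (Set.Icc a b ×ˢ Set.univ)) {t : ℝ} (ht : t ∈ Set.Ioo a b) (θ : ℝ)
    (i : Fin 2) : fderiv ℝ v (t, θ) (coordVec i) = partialDeriv a b v i (t, θ) := by
  have h := hasFDerivAt_of_mem_Ioo hv ht θ
  rw [partialDeriv_eq_fderivWithin hab (Set.Ioo_subset_Icc_self ht)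
    h.differentiableAt.differentiableWithinAt, fderivWithin_of_mem_nhds (strip_mem_nhds ht θ)]

/-! ### Reduction of rotational metrics to the flat cylinder -/

theorem rotationalMetric_inv {f : ℝ → ℝ} {t : ℝ} (h : 0 < f t) (θ : ℝ) :
    (rotationalMetric f (t, θ))⁻¹ = ((f t ^ 2)⁻¹) • (1 : Matrix (Fin 2) (Fin 2) ℝ) := by
  refine Matrix.inv_eq_right_inv ?_
  simp only [rotationalMetric, Matrix.mul_smul, mul_one, smul_smul]
  rw [inv_mul_cancel₀ (pow_pos h 2).ne', one_smul]

theorem sqrt_det_rotationalMetric (f : ℝ → ℝ) (t θ : ℝ) :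
    Real.sqrt (rotationalMetric f (t, θ)).det = f t ^ 2 := by
  simp only [rotationalMetric, Matrix.det_smul, Fintype.card_fin, Matrix.det_one, mul_one]
  exact Real.sqrt_sq (sq_nonneg _)

theorem gradient_rotationalMetric {a b : ℝ} {f : ℝ → ℝ} {t : ℝ} (h : 0 < f t) (u : ℝ × ℝ → ℝ)
    (i : Fin 2) (θ : ℝ) : gradient a b (rotationalMetric f) u i (t, θ) =
      (f t ^ 2)⁻¹ * partialDeriv a b u i (t, θ) := by
  simp [gradient, rotationalMetric_inv h, Matrix.one_apply]

theorem laplacian_rotationalMetric {a b : ℝ} {f : ℝ → ℝ} (h : ∀ t ∈ Set.Icc a b, 0 < f t)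
    (u : ℝ × ℝ → ℝ) {t : ℝ} (ht : t ∈ Set.Icc a b) (θ : ℝ) :
    laplacian a b (rotationalMetric f) u (t, θ) = (f t ^ 2)⁻¹ *
      (partialDeriv a b (partialDeriv a b u 0) 0 (t, θ) +
        partialDeriv a b (partialDeriv a b u 1) 1 (t, θ)) := by
  have e (i : Fin 2) : ∀ s ∈ Set.Icc a b, ∀ η, Real.sqrt (rotationalMetric f (s, η)).det *
      gradient a b (rotationalMetric f) u i (s, η) = partialDeriv a b u i (s, η) := by
    intro s hs η
    rw [sqrt_det_rotationalMetric, gradient_rotationalMetric (h s hs),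
      mul_inv_cancel_left₀ (pow_pos (h s hs) 2).ne']
  rw [laplacian, sqrt_det_rotationalMetric, Fin.sum_univ_two, partialDeriv_congr (e 0) 0 ht,
    partialDeriv_congr (e 1) 1 ht]

theorem laplacian_rotationalMetric_eq_zero_iff {a b : ℝ} {f : ℝ → ℝ}
    (h : ∀ t ∈ Set.Icc a b, 0 < f t) (u : ℝ × ℝ → ℝ) {t : ℝ} (ht : t ∈ Set.Icc a b) (θ : ℝ) :
    laplacian a b (rotationalMetric f) u (t, θ) = 0 ↔
      partialDeriv a b (partialDeriv a b u 0) 0 (t, θ) +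
        partialDeriv a b (partialDeriv a b u 1) 1 (t, θ) = 0 := by
  rw [laplacian_rotationalMetric h u ht, mul_eq_zero_iff_left (inv_ne_zero (pow_pos (h t ht) 2).ne')]

theorem normalDeriv_rotationalMetric {a b : ℝ} {f : ℝ → ℝ} {t : ℝ} (h : 0 < f t)
    (u : ℝ × ℝ → ℝ) (θ : ℝ) :
    normalDeriv a b (rotationalMetric f) u (t, θ) = partialDeriv a b u 0 (t, θ) / f t := by
  rw [normalDeriv, gradient_rotationalMetric h, rotationalMetric_inv h]
  simp only [Matrix.smul_apply, Matrix.one_apply_eq, smul_eq_mul, mul_one]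
  rw [Real.sqrt_inv, Real.sqrt_sq h.le]
  field_simp

theorem boundaryLength_rotationalMetric {a b : ℝ} {f : ℝ → ℝ} (ha : 0 < f a) (hb : 0 < f b) :
    boundaryLength a b (rotationalMetric f) = 2 * Real.pi * (f a + f b) := by
  simp [boundaryLength, rotationalMetric, Real.sqrt_sq ha.le, Real.sqrt_sq hb.le]
  ring

/-! ### Green's identity and Fourier coefficients -/

/-- Green's identity on the cylinder for a harmonic function `u` and the product `w(t) e(θ)`, where
`w'' = κ w` and `e'' = -κ e`. -/
theorem green_identity {a b : ℝ} (hab : a < b) {u : ℝ × ℝ → ℝ}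
    (hu : ContDiffOn ℝ ∞ u (Set.Icc a b ×ˢ Set.univ))
    (hper : ∀ t ∈ Set.Icc a b, ∀ θ, u (t, θ + 2 * Real.pi) = u (t, θ))
    (hharm : ∀ t ∈ Set.Ioo a b, ∀ θ, partialDeriv a b (partialDeriv a b u 0) 0 (t, θ) +
        partialDeriv a b (partialDeriv a b u 1) 1 (t, θ) = 0)
    {κ : ℝ} {w w' e e' : ℝ → ℝ} (hw : ∀ t, HasDerivAt w (w' t) t)
    (hw' : ∀ t, HasDerivAt w' (κ * w t) t) (he : ∀ θ, HasDerivAt e (e' θ) θ)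
    (he' : ∀ θ, HasDerivAt e' (-κ * e θ) θ) (heper : e (2 * Real.pi) = e 0)
    (heper' : e' (2 * Real.pi) = e' 0) :
    ∫ θ in (0 : ℝ)..(2 * Real.pi), (partialDeriv a b u 0 (b, θ) * w b - u (b, θ) * w' b) * e θ =
      ∫ θ in (0 : ℝ)..(2 * Real.pi),
        (partialDeriv a b u 0 (a, θ) * w a - u (a, θ) * w' a) * e θ := by
  have hpi : (0 : ℝ) < 2 * Real.pi := by positivity
  have hu0 := contDiffOn_partialDeriv hab hu 0
  have hu1 := contDiffOn_partialDeriv hab hu 1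
  have cw : Continuous w := continuous_iff_continuousAt.2 fun t => (hw t).continuousAt
  have cw' : Continuous w' := continuous_iff_continuousAt.2 fun t => (hw' t).continuousAt
  have ce : Continuous e := continuous_iff_continuousAt.2 fun t => (he t).continuousAt
  have ce' : Continuous e' := continuous_iff_continuousAt.2 fun t => (he' t).continuousAt
  -- `(F, G)` is the field `w e ∇u - u ∇(w e)`, divergence-free because `u` and `w e` are both
  -- harmonic.
  set F : ℝ × ℝ → ℝ := fun p => (partialDeriv a b u 0 p * w p.1 - u p * w' p.1) * e p.2 with hF
  set G : ℝ × ℝ → ℝ := fun p => (partialDeriv a b u 1 p * e p.2 - u p * e' p.2) * w p.1 with hG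
  set D : Set (ℝ × ℝ) := Set.Ioo a b ×ˢ Set.univ with hD
  classical
  -- Extending the derivatives by zero off the open strip makes the divergence vanish identically,
  -- so its integrability over the closed rectangle is immediate.
  let F' : ℝ × ℝ → ℝ × ℝ →L[ℝ] ℝ := fun p => if p ∈ D then fderiv ℝ F p else 0
  let G' : ℝ × ℝ → ℝ × ℝ →L[ℝ] ℝ := fun p => if p ∈ D then fderiv ℝ G p else 0
  have dF : ∀ p ∈ D, DifferentiableAt ℝ F p ∧ DifferentiableAt ℝ G p ∧
      fderiv ℝ F p (1, 0) + fderiv ℝ G p (0, 1) = 0 := by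
    rintro ⟨t, θ⟩ ⟨ht, -⟩
    have d := hasFDerivAt_of_mem_Ioo hu ht θ
    have d0 := hasFDerivAt_of_mem_Ioo hu0 ht θ
    have d1 := hasFDerivAt_of_mem_Ioo hu1 ht θ
    have dw := (hw t).comp_hasFDerivAt (t, θ) (hasFDerivAt_fst (𝕜 := ℝ) (E := ℝ) (F := ℝ))
    have dw' := (hw' t).comp_hasFDerivAt (t, θ) (hasFDerivAt_fst (𝕜 := ℝ) (E := ℝ) (F := ℝ))
    have de := (he θ).comp_hasFDerivAt (t, θ) (hasFDerivAt_snd (𝕜 := ℝ) (E := ℝ) (F := ℝ))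
    have de' := (he' θ).comp_hasFDerivAt (t, θ) (hasFDerivAt_snd (𝕜 := ℝ) (E := ℝ) (F := ℝ))
    have hFd := ((d0.mul dw).sub (d.mul dw')).mul de
    have hGd := ((d1.mul de).sub (d.mul de')).mul dw
    have eF : fderiv ℝ F (t, θ) = _ := hFd.fderiv
    have eG : fderiv ℝ G (t, θ) = _ := hGd.fderiv
    refine ⟨hFd.differentiableAt, hGd.differentiableAt, ?_⟩
    have p0 := fderiv_coordVec hab hu ht θ 0
    have p1 := fderiv_coordVec hab hu ht θ 1
    have p00 := fderiv_coordVec hab hu0 ht θ 0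
    have p11 := fderiv_coordVec hab hu1 ht θ 1
    simp only [coordVec, if_true, one_ne_zero, if_false] at p0 p1 p00 p11
    rw [eF, eG]
    simp [p0, p1, p00, p11]
    linear_combination (w t * e θ) * hharm t ht θ
  have key := MeasureTheory.integral2_divergence_prod_of_hasFDerivAt F G F' G' a 0 b (2 * Real.pi)
    ?_ ?_ ?_ ?_ ?_
  · have z : ∀ x : ℝ × ℝ, F' x (1, 0) + G' x (0, 1) = 0 := fun x => by
      by_cases hx : x ∈ D
      · simpa [F', G', hx] using (dF x hx).2.2
      · simp [F', G', hx]
    have hGper : ∀ t ∈ Set.Icc a b, G (t, 2 * Real.pi) = G (t, 0) := by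
      intro t ht
      have h0 : u (t, 2 * Real.pi) = u (t, 0) := by simpa using hper t ht 0
      have h1 : partialDeriv a b u 1 (t, 2 * Real.pi) = partialDeriv a b u 1 (t, 0) := by
        simp only [partialDeriv, one_ne_zero, if_false]
        have := deriv_comp_add_const (fun η => u (t, η)) (2 * Real.pi) 0
        rw [zero_add] at this
        rw [← this]
        simp only [hper t ht]
      simp only [hG, h0, h1, heper, heper']
    have hGint : ∫ x in a..b, G (x, 2 * Real.pi) = ∫ x in a..b, G (x, 0) :=
      intervalIntegral.integral_congr fun t ht => hGper t (by rwa [Set.uIcc_of_le hab.le] at ht)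
    simp only [z, intervalIntegral.integral_zero, hGint, sub_self, zero_add] at key
    exact (sub_eq_zero.1 key.symm)
  · have hsub : Set.uIcc a b ×ˢ Set.uIcc 0 (2 * Real.pi) ⊆ Set.Icc a b ×ˢ Set.univ := by
      rw [Set.uIcc_of_le hab.le]; exact Set.prod_mono le_rfl (Set.subset_univ _)
    refine ContinuousOn.mono ?_ hsub
    exact ((hu0.continuousOn.mul (cw.comp continuous_fst).continuousOn).sub
      (hu.continuousOn.mul (cw'.comp continuous_fst).continuousOn)).mul
      (ce.comp continuous_snd).continuousOn
  · have hsub : Set.uIcc a b ×ˢ Set.uIcc 0 (2 * Real.pi) ⊆ Set.Icc a b ×ˢ Set.univ := by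
      rw [Set.uIcc_of_le hab.le]; exact Set.prod_mono le_rfl (Set.subset_univ _)
    refine ContinuousOn.mono ?_ hsub
    exact ((hu1.continuousOn.mul (ce.comp continuous_snd).continuousOn).sub
      (hu.continuousOn.mul (ce'.comp continuous_snd).continuousOn)).mul
      (cw.comp continuous_fst).continuousOn
  · rintro x ⟨hx, -⟩
    rw [min_eq_left hab.le, max_eq_right hab.le] at hx
    have hxD : x ∈ D := ⟨hx, Set.mem_univ _⟩
    simpa [F', hxD] using (dF x hxD).1.hasFDerivAt
  · rintro x ⟨hx, -⟩
    rw [min_eq_left hab.le, max_eq_right hab.le] at hx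
    have hxD : x ∈ D := ⟨hx, Set.mem_univ _⟩
    simpa [G', hxD] using (dF x hxD).2.1.hasFDerivAt
  · have z : (fun x : ℝ × ℝ => F' x (1, 0) + G' x (0, 1)) = fun _ => 0 := by
      funext x
      by_cases hx : x ∈ D
      · simpa [F', G', hx] using (dF x hx).2.2
      · simp [F', G', hx]
    rw [z]
    exact MeasureTheory.integrableOn_zero

theorem IsHarmonicExtension.continuous_left {a b : ℝ} (hab : a < b) {g : MetricComponents}
    {φ : BoundaryFunction} {u : ℝ × ℝ → ℝ} (h : IsHarmonicExtension a b g φ u) :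
    Continuous φ.1 := by
  have : φ.1 = fun θ => u (a, θ) := funext fun θ => (h.left_value θ).symm
  rw [this]
  exact h.smooth.continuousOn.comp_continuous (by fun_prop)
    fun θ => ⟨Set.left_mem_Icc.2 hab.le, Set.mem_univ _⟩

theorem IsHarmonicExtension.continuous_right {a b : ℝ} (hab : a < b) {g : MetricComponents}
    {φ : BoundaryFunction} {u : ℝ × ℝ → ℝ} (h : IsHarmonicExtension a b g φ u) :
    Continuous φ.2 := by
  have : φ.2 = fun θ => u (b, θ) := funext fun θ => (h.right_value θ).symm
  rw [this]
  exact h.smooth.continuousOn.comp_continuous (by fun_prop)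
    fun θ => ⟨Set.right_mem_Icc.2 hab.le, Set.mem_univ _⟩

theorem IsHarmonicExtension.periodic_left {a b : ℝ} (hab : a < b) {g : MetricComponents}
    {φ : BoundaryFunction} {u : ℝ × ℝ → ℝ} (h : IsHarmonicExtension a b g φ u) :
    Function.Periodic φ.1 (2 * Real.pi) := fun θ => by
  rw [← h.left_value, ← h.left_value, h.periodic a (Set.left_mem_Icc.2 hab.le)]

theorem IsHarmonicExtension.periodic_right {a b : ℝ} (hab : a < b) {g : MetricComponents}
    {φ : BoundaryFunction} {u : ℝ × ℝ → ℝ} (h : IsHarmonicExtension a b g φ u) :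
    Function.Periodic φ.2 (2 * Real.pi) := fun θ => by
  rw [← h.right_value, ← h.right_value, h.periodic b (Set.right_mem_Icc.2 hab.le)]

/-- The equation between the Fourier coefficients on the two boundary circles of an eigenfunction
of the Dirichlet-to-Neumann map. -/
theorem fourier_relation {a b : ℝ} (hab : a < b) {f : ℝ → ℝ} (hf : ∀ t ∈ Set.Icc a b, 0 < f t)
    {φ : BoundaryFunction} {s : ℝ} (h : IsDirichletToNeumann a b (rotationalMetric f) φ (s • φ))
    {κ : ℝ} {w w' e e' : ℝ → ℝ} (hw : ∀ t, HasDerivAt w (w' t) t)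
    (hw' : ∀ t, HasDerivAt w' (κ * w t) t) (he : ∀ θ, HasDerivAt e (e' θ) θ)
    (he' : ∀ θ, HasDerivAt e' (-κ * e θ) θ) (heper : e (2 * Real.pi) = e 0)
    (heper' : e' (2 * Real.pi) = e' 0) :
    (s * f b * w b - w' b) * (∫ θ in (0 : ℝ)..(2 * Real.pi), φ.2 θ * e θ) +
      (s * f a * w a + w' a) * (∫ θ in (0 : ℝ)..(2 * Real.pi), φ.1 θ * e θ) = 0 := by
  obtain ⟨u, hu, hl, hr⟩ := h
  have ha := hf a (Set.left_mem_Icc.2 hab.le)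
  have hb := hf b (Set.right_mem_Icc.2 hab.le)
  have hG := green_identity hab hu.smooth hu.periodic (fun t ht θ =>
    (laplacian_rotationalMetric_eq_zero_iff hf u (Set.Ioo_subset_Icc_self ht) θ).1
      (hu.harmonic t ht θ)) hw hw' he he' heper heper'
  have e1 : ∀ θ, partialDeriv a b u 0 (a, θ) = -(s * f a * φ.1 θ) := fun θ => by
    have := hl θ
    rw [normalDeriv_rotationalMetric ha] at this
    simp only [Prod.smul_fst, Pi.smul_apply, smul_eq_mul] at this
    field_simp at this
    linarith
  have e2 : ∀ θ, partialDeriv a b u 0 (b, θ) = s * f b * φ.2 θ := fun θ => by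
    have := hr θ
    rw [normalDeriv_rotationalMetric hb] at this
    simp only [Prod.smul_snd, Pi.smul_apply, smul_eq_mul] at this
    field_simp at this
    linarith
  simp only [e1, e2, hu.left_value, hu.right_value] at hG
  have i1 : ∀ θ, (s * f b * φ.2 θ * w b - φ.2 θ * w' b) * e θ =
      (s * f b * w b - w' b) * (φ.2 θ * e θ) := fun θ => by ring
  have i2 : ∀ θ, (-(s * f a * φ.1 θ) * w a - φ.1 θ * w' a) * e θ =
      (-(s * f a * w a + w' a)) * (φ.1 θ * e θ) := fun θ => by ring
  simp only [i1, i2, intervalIntegral.integral_const_mul] at hG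
  linarith

/-- A continuous `2π`-periodic function whose Fourier coefficients vanish is zero. -/
theorem eq_zero_of_fourier_coeff_eq_zero {φ : ℝ → ℝ} (hc : Continuous φ)
    (hp : Function.Periodic φ (2 * Real.pi))
    (hcos : ∀ n : ℕ, ∫ θ in (0 : ℝ)..(2 * Real.pi), φ θ * Real.cos (n * θ) = 0)
    (hsin : ∀ n : ℕ, ∫ θ in (0 : ℝ)..(2 * Real.pi), φ θ * Real.sin (n * θ) = 0) : φ = 0 := by
  have : Fact (0 < 2 * Real.pi) := ⟨by positivity⟩
  have hp' : Function.Periodic (fun θ => (φ θ : ℂ)) (2 * Real.pi) := fun θ => by simp [hp θ]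
  let F : C(AddCircle (2 * Real.pi), ℂ) := ⟨hp'.lift, 
    (QuotientAddGroup.isQuotientMap_mk _).continuous_iff.2 (Complex.continuous_ofReal.comp hc)⟩
  have hF : ∀ θ : ℝ, F (θ : AddCircle (2 * Real.pi)) = φ θ := fun θ => hp'.lift_coe θ
  have hcosz : ∀ n : ℤ, ∫ θ in (0 : ℝ)..(2 * Real.pi), φ θ * Real.cos (n * θ) = 0 := by
    intro n
    obtain ⟨m, rfl | rfl⟩ := n.eq_nat_or_neg
    · simpa using hcos m
    · simpa using hcos m
  have hsinz : ∀ n : ℤ, ∫ θ in (0 : ℝ)..(2 * Real.pi), φ θ * Real.sin (n * θ) = 0 := by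
    intro n
    obtain ⟨m, rfl | rfl⟩ := n.eq_nat_or_neg
    · simpa using hsin m
    · simpa using hsin m
  have hcoeff : fourierCoeff F = 0 := by
    funext n
    rw [fourierCoeff_eq_intervalIntegral _ _ 0, zero_add]
    have e : ∀ θ : ℝ, (fourier (-n) (θ : AddCircle (2 * Real.pi)) : ℂ) • F θ =
        ((φ θ * Real.cos (n * θ) : ℝ) : ℂ) - ((φ θ * Real.sin (n * θ) : ℝ) : ℂ) * Complex.I := by
      intro θ
      rw [hF, fourier_coe_apply]
      have e2 : 2 * (Real.pi : ℂ) * Complex.I * ((-n : ℤ) : ℂ) * θ / ((2 * Real.pi : ℝ) : ℂ) =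
          ((-(n * θ) : ℝ) : ℂ) * Complex.I := by
        have : (Real.pi : ℂ) ≠ 0 := by exact_mod_cast Real.pi_ne_zero
        push_cast
        field_simp
      rw [e2, Complex.exp_mul_I, ← Complex.ofReal_cos, ← Complex.ofReal_sin, Real.cos_neg,
        Real.sin_neg, smul_eq_mul]
      push_cast
      ring
    simp only [e]
    rw [intervalIntegral.integral_sub, intervalIntegral.integral_mul_const,
      intervalIntegral.integral_ofReal, intervalIntegral.integral_ofReal, hcosz, hsinz]
    · simp
    · exact Continuous.intervalIntegrable (by fun_prop) _ _
    · exact Continuous.intervalIntegrable (by fun_prop) _ _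
  funext θ
  -- Zero coefficients are summable, so the series converges to `F` at every point, and its sum is
  -- zero.
  have hs := has_pointwise_sum_fourier_series_of_summable (f := F)
    (by rw [hcoeff]; exact summable_zero) (θ : AddCircle (2 * Real.pi))
  simp only [hcoeff, Pi.zero_apply, zero_smul] at hs
  have := hs.unique hasSum_zero
  rw [hF] at this
  exact_mod_cast this

/-! ### Eigenfunctions by separation of variables -/

/-- The boundary function `A e(θ)` on the left circle and `B e(θ)` on the right one. -/
def boundaryMode (A B : ℝ) (e : ℝ → ℝ) : BoundaryFunction :=
  (fun θ => A * e θ, fun θ => B * e θ)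

/-- `e` is a smooth `2π`-periodic function with `e'' = -n² e`. -/
structure IsFourierMode (n : ℕ) (e e' : ℝ → ℝ) : Prop where
  smooth : ContDiff ℝ ∞ e
  hasDerivAt : ∀ θ, HasDerivAt e (e' θ) θ
  hasDerivAt' : ∀ θ, HasDerivAt e' (-(n : ℝ) ^ 2 * e θ) θ
  periodic : Function.Periodic e (2 * Real.pi)
  periodic' : Function.Periodic e' (2 * Real.pi)

theorem isFourierMode_cos (n : ℕ) :
    IsFourierMode n (fun θ => Real.cos (n * θ)) (fun θ => -(n * Real.sin (n * θ))) where
  smooth := Real.contDiff_cos.comp (contDiff_const.mul contDiff_id)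
  hasDerivAt θ := (((hasDerivAt_id' θ).const_mul (n : ℝ)).cos).congr_deriv (by ring)
  hasDerivAt' θ :=
    ((((hasDerivAt_id' θ).const_mul (n : ℝ)).sin).const_mul (n : ℝ)).neg.congr_deriv (by ring)
  periodic θ := by
    simp only [mul_add, Real.cos_add_nat_mul_two_pi]
  periodic' θ := by
    simp only [mul_add, Real.sin_add_nat_mul_two_pi]

theorem isFourierMode_sin (n : ℕ) :
    IsFourierMode n (fun θ => Real.sin (n * θ)) (fun θ => n * Real.cos (n * θ)) where
  smooth := Real.contDiff_sin.comp (contDiff_const.mul contDiff_id)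
  hasDerivAt θ := (((hasDerivAt_id' θ).const_mul (n : ℝ)).sin).congr_deriv (by ring)
  hasDerivAt' θ :=
    ((((hasDerivAt_id' θ).const_mul (n : ℝ)).cos).const_mul (n : ℝ)).congr_deriv (by ring)
  periodic θ := by
    simp only [mul_add, Real.sin_add_nat_mul_two_pi]
  periodic' θ := by
    simp only [mul_add, Real.cos_add_nat_mul_two_pi]

theorem isFourierMode_one : IsFourierMode 0 (fun _ => 1) (fun _ => 0) where
  smooth := contDiff_const
  hasDerivAt θ := hasDerivAt_const θ 1
  hasDerivAt' θ := by simpa using hasDerivAt_const θ (0 : ℝ)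
  periodic θ := rfl
  periodic' θ := rfl

theorem isDirichletToNeumann_boundaryMode {a b : ℝ} (hab : a < b) {f : ℝ → ℝ}
    (hf : ∀ t ∈ Set.Icc a b, 0 < f t) {n : ℕ} {e e' h h' : ℝ → ℝ} (he : IsFourierMode n e e')
    (hs : ContDiff ℝ ∞ h) (hh : ∀ t, HasDerivAt h (h' t) t)
    (hh' : ∀ t, HasDerivAt h' ((n : ℝ) ^ 2 * h t) t) {s : ℝ} (hl : -h' a = s * f a * h a)
    (hr : h' b = s * f b * h b) :
    IsDirichletToNeumann a b (rotationalMetric f) (boundaryMode (h a) (h b) e)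
      (s • boundaryMode (h a) (h b) e) := by
  have ha := hf a (Set.left_mem_Icc.2 hab.le)
  have hb := hf b (Set.right_mem_Icc.2 hab.le)
  have d0 : ∀ (k k' : ℝ → ℝ), (∀ t, HasDerivAt k (k' t) t) → ∀ t ∈ Set.Icc a b, ∀ θ,
      partialDeriv a b (fun p => k p.1 * e p.2) 0 (t, θ) = k' t * e θ := by
    intro k k' hk t ht θ
    simpa [partialDeriv] using
      ((hk t).mul_const (e θ)).hasDerivWithinAt.derivWithin (uniqueDiffOn_Icc hab t ht)
  have d1 : ∀ (k k' : ℝ → ℝ), (∀ t, HasDerivAt k (k' t) t) → ∀ t θ,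
      partialDeriv a b (fun p => h p.1 * k p.2) 1 (t, θ) = h t * k' θ := by
    intro k k' hk t θ
    simpa [partialDeriv] using ((hk θ).const_mul (h t)).deriv
  refine ⟨fun p => h p.1 * e p.2, ⟨?_, ?_, ?_, fun _ => rfl, fun _ => rfl⟩, ?_, ?_⟩
  · exact ((hs.comp contDiff_fst).mul (he.smooth.comp contDiff_snd)).contDiffOn
  · intro t _ θ
    simp only [he.periodic θ]
  · intro t ht θ
    have ht' := Set.Ioo_subset_Icc_self ht
    rw [laplacian_rotationalMetric_eq_zero_iff hf _ ht',
      partialDeriv_congr (v' := fun p => h' p.1 * e p.2) (d0 h h' hh) 0 ht',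
      partialDeriv_congr (v' := fun p => h p.1 * e' p.2)
        (fun t _ θ => d1 e e' he.hasDerivAt t θ) 1 ht',
      d0 h' _ hh' t ht', d1 e' _ he.hasDerivAt']
    ring
  · intro θ
    rw [normalDeriv_rotationalMetric ha, d0 h h' hh a (Set.left_mem_Icc.2 hab.le)]
    simp only [boundaryMode, Prod.smul_fst, Pi.smul_apply, smul_eq_mul]
    field_simp
    linear_combination (-e θ) * hl
  · intro θ
    rw [normalDeriv_rotationalMetric hb, d0 h h' hh b (Set.right_mem_Icc.2 hab.le)]
    simp only [boundaryMode, Prod.smul_snd, Pi.smul_apply, smul_eq_mul]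
    field_simp
    linear_combination (-e θ) * hr

/-- For `n ≥ 1`, a root `s` of the characteristic polynomial of the `n`-th Fourier block of the
Dirichlet-to-Neumann map is an eigenvalue. -/
theorem isDirichletToNeumann_of_char_eq_zero {a b : ℝ} (hab : a < b) {f : ℝ → ℝ}
    (hf : ∀ t ∈ Set.Icc a b, 0 < f t) {n : ℕ} (hn : 0 < n) {e e' : ℝ → ℝ}
    (he : IsFourierMode n e e') {s : ℝ}
    (hs : f a * f b * s ^ 2 - n * (Real.cosh (n * (b - a)) / Real.sinh (n * (b - a))) *
      (f a + f b) * s + n ^ 2 = 0) :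
    IsDirichletToNeumann a b (rotationalMetric f)
      (boundaryMode n (n * Real.cosh (n * (b - a)) - s * f a * Real.sinh (n * (b - a))) e)
      (s • boundaryMode n
        (n * Real.cosh (n * (b - a)) - s * f a * Real.sinh (n * (b - a))) e) := by
  have hn' : (0 : ℝ) < n := by exact_mod_cast hn
  have hS : 0 < Real.sinh (n * (b - a)) := Real.sinh_pos_iff.2 (mul_pos hn' (sub_pos.2 hab))
  have hC := Real.cosh_sq (n * (b - a))
  set S := Real.sinh (n * (b - a)) with hSdef
  set C := Real.cosh (n * (b - a)) with hCdef
  -- With boundary value `n` at `a`, this value at `b` is forced by the Steklov condition at `a`;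
  -- the condition at `b` then becomes the characteristic equation, by `C² = S² + 1`.
  set B := n * C - s * f a * S with hB
  let h : ℝ → ℝ := fun t => (n * Real.sinh (n * (b - t)) + B * Real.sinh (n * (t - a))) / S
  let h' : ℝ → ℝ := fun t =>
    n * (-(n * Real.cosh (n * (b - t))) + B * Real.cosh (n * (t - a))) / S
  have l1 : ∀ t, HasDerivAt (fun t => (n : ℝ) * (b - t)) (-n) t := fun t =>
    (((hasDerivAt_id' t).const_sub b).const_mul (n : ℝ)).congr_deriv (by ring)
  have l2 : ∀ t, HasDerivAt (fun t => (n : ℝ) * (t - a)) n t := fun t =>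
    (((hasDerivAt_id' t).sub_const a).const_mul (n : ℝ)).congr_deriv (by ring)
  have hh : ∀ t, HasDerivAt h (h' t) t := fun t =>
    ((((l1 t).sinh.const_mul (n : ℝ)).add ((l2 t).sinh.const_mul B)).div_const S).congr_deriv
      (by simp only [h']; ring)
  have hh' : ∀ t, HasDerivAt h' ((n : ℝ) ^ 2 * h t) t := fun t =>
    (((((l1 t).cosh.const_mul (n : ℝ)).neg.add ((l2 t).cosh.const_mul B)).const_mul
      (n : ℝ)).div_const S).congr_deriv (by simp only [h]; ring)
  have hsm : ContDiff ℝ ∞ h := by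
    refine ContDiff.div_const ?_ S
    exact (contDiff_const.mul (Real.contDiff_sinh.comp
      (contDiff_const.mul (contDiff_const.sub contDiff_id)))).add (contDiff_const.mul
        (Real.contDiff_sinh.comp (contDiff_const.mul (contDiff_id.sub contDiff_const))))
  have ha : h a = n := by
    simp only [h, sub_self, mul_zero, Real.sinh_zero, add_zero, ← hSdef]
    field_simp
  have hb : h b = B := by
    simp only [h, sub_self, mul_zero, Real.sinh_zero, zero_add, ← hSdef]
    field_simp
  have hs' : f a * f b * s ^ 2 * S - n * C * (f a + f b) * s + n ^ 2 * S = 0 := by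
    field_simp at hs
    linarith
  have key := isDirichletToNeumann_boundaryMode hab hf he hsm hh hh' (s := s) ?_ ?_
  · rwa [ha, hb] at key
  · rw [ha]
    simp only [h', sub_self, mul_zero, Real.cosh_zero, ← hCdef]
    rw [hB]
    field_simp
    ring
  · rw [hb]
    simp only [h', sub_self, mul_zero, Real.cosh_zero, ← hCdef]
    rw [div_eq_iff hS.ne', hB]
    linear_combination (n : ℝ) ^ 2 * hC + S * hs'

theorem isDirichletToNeumann_const {a b : ℝ} (hab : a < b) {f : ℝ → ℝ}
    (hf : ∀ t ∈ Set.Icc a b, 0 < f t) :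
    IsDirichletToNeumann a b (rotationalMetric f) (boundaryMode 1 1 fun _ => 1)
      ((0 : ℝ) • boundaryMode 1 1 fun _ => 1) :=
  isDirichletToNeumann_boundaryMode hab hf isFourierMode_one (h := fun _ => 1) (h' := fun _ => 0)
    contDiff_const (fun t => hasDerivAt_const t 1) (fun t => by simpa using hasDerivAt_const t 0)
    (by simp) (by simp)

/-! ### Upper bound: five eigenfunctions -/

theorem linearIndependent_modes_one_one {B B' : ℝ} (h : B ≠ B') :
    LinearIndependent ℝ ![boundaryMode 1 1 fun _ => 1,
      boundaryMode (1 : ℕ) B fun θ => Real.cos ((1 : ℕ) * θ),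
      boundaryMode (1 : ℕ) B fun θ => Real.sin ((1 : ℕ) * θ),
      boundaryMode (1 : ℕ) B' fun θ => Real.cos ((1 : ℕ) * θ),
      boundaryMode (1 : ℕ) B' fun θ => Real.sin ((1 : ℕ) * θ)] := by
  rw [Fintype.linearIndependent_iff]
  intro g hg
  have h1 : ∀ θ, g 0 + (g 1 + g 3) * Real.cos θ + (g 2 + g 4) * Real.sin θ = 0 := fun θ => by
    have := congrFun (congrArg Prod.fst hg) θ
    simp [Fin.sum_univ_five, boundaryMode] at this
    linear_combination this
  have h2 : ∀ θ, g 0 + (g 1 * B + g 3 * B') * Real.cos θ +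
      (g 2 * B + g 4 * B') * Real.sin θ = 0 := fun θ => by
    have := congrFun (congrArg Prod.snd hg) θ
    simp [Fin.sum_univ_five, boundaryMode] at this
    linear_combination this
  have a0 := h1 0
  have a1 := h1 Real.pi
  have a2 := h1 (Real.pi / 2)
  have b0 := h2 0
  have b2 := h2 (Real.pi / 2)
  simp at a0 a1 a2 b0 b2
  have g0 : g 0 = 0 := by linarith
  have hB : B - B' ≠ 0 := sub_ne_zero.2 h
  have g1 : g 1 = 0 := by
    have : g 1 * (B - B') = 0 := by linear_combination b0 - g0 - B' * (a0 - g0)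
    exact (mul_eq_zero.1 this).resolve_right hB
  have g2 : g 2 = 0 := by
    have : g 2 * (B - B') = 0 := by linear_combination b2 - g0 - B' * (a2 - g0)
    exact (mul_eq_zero.1 this).resolve_right hB
  have g3 : g 3 = 0 := by linarith
  have g4 : g 4 = 0 := by linarith
  intro i
  fin_cases i <;> assumption

theorem linearIndependent_modes_one_two (B B' : ℝ) :
    LinearIndependent ℝ ![boundaryMode 1 1 fun _ => 1,
      boundaryMode (1 : ℕ) B fun θ => Real.cos ((1 : ℕ) * θ),
      boundaryMode (1 : ℕ) B fun θ => Real.sin ((1 : ℕ) * θ),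
      boundaryMode (2 : ℕ) B' fun θ => Real.cos ((2 : ℕ) * θ),
      boundaryMode (2 : ℕ) B' fun θ => Real.sin ((2 : ℕ) * θ)] := by
  rw [Fintype.linearIndependent_iff]
  intro g hg
  have h1 : ∀ θ, g 0 + g 1 * Real.cos θ + g 2 * Real.sin θ + g 3 * 2 * Real.cos (2 * θ) +
      g 4 * 2 * Real.sin (2 * θ) = 0 := fun θ => by
    have := congrFun (congrArg Prod.fst hg) θ
    simp [Fin.sum_univ_five, boundaryMode] at this
    linear_combination this
  have a0 := h1 0
  have a1 := h1 Real.pi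
  have a2 := h1 (Real.pi / 2)
  have a3 := h1 (-(Real.pi / 2))
  have a4 := h1 (Real.pi / 4)
  rw [show 2 * (Real.pi / 4) = Real.pi / 2 by ring] at a4
  rw [show 2 * (Real.pi / 2) = Real.pi by ring] at a2
  rw [show 2 * -(Real.pi / 2) = -Real.pi by ring] at a3
  simp at a0 a1 a2 a3 a4
  have g1 : g 1 = 0 := by linarith
  have g2 : g 2 = 0 := by linarith
  have g0 : g 0 = 0 := by linarith
  have g3 : g 3 = 0 := by linarith
  have g4 : g 4 = 0 := by
    rw [g0, g1, g2] at a4; linarith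
  intro i
  fin_cases i <;> assumption

/-- With `c = coth L`, this says that `Q 1 M ≤ 0` implies `Q 2 M ≤ 0`. If it failed, subtracting the
hypothesis would give `3c > 2r`, while `z ≤ 1` would give `2r(c² + 1) < 7c`. Multiplied by `r`, the
latter reads `(3c - 2r)(2c - r) < 0`, impossible for `c > 2r/3`. -/
theorem coth_inequality {c r z : ℝ} (hr : 0 < r) (hr2 : r ^ 2 = 3) (hc : 0 < c) (hz : z ≤ 1)
    (h : 3 * z + 1 - 2 * r * c ≤ 0) : 3 * z - 2 * r * (c + 1 / c) + 4 ≤ 0 := by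
  by_contra! hlt
  have e : r * (1 / c) * c = r := by field_simp
  have h1 : 2 * (r * (1 / c)) < 3 := by nlinarith
  have h2 : 2 * r < 3 * c := by nlinarith
  have h3 : 2 * r * (c + 1 / c) < 7 := by linarith
  have h4 : 2 * r * (c ^ 2 + 1) < 7 * c := by
    have e2 : 2 * r * (c ^ 2 + 1) = 2 * r * (c + 1 / c) * c := by field_simp
    rw [e2]; nlinarith
  nlinarith [mul_pos (sub_pos.2 h2) hr, mul_pos (sub_pos.2 h2) hc]

/-- There are five linearly independent eigenfunctions with eigenvalues at most
`2 √3 / (f(a) + f(b))`. -/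
theorem exists_five_eigenfunctions {a b : ℝ} (hab : a < b) {f : ℝ → ℝ}
    (hf : ∀ t ∈ Set.Icc a b, 0 < f t) :
    ∃ φ : Fin (4 + 1) → BoundaryFunction, LinearIndependent ℝ φ ∧
      ∀ i, ∃ s ≤ 2 * Real.sqrt 3 / (f a + f b),
        IsDirichletToNeumann a b (rotationalMetric f) (φ i) (s • φ i) := by
  have ha := hf a (Set.left_mem_Icc.2 hab.le)
  have hb := hf b (Set.right_mem_Icc.2 hab.le)
  have hT : 0 < b - a := sub_pos.2 hab
  set r := Real.sqrt 3 with hr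
  have hr2 : r ^ 2 = 3 := Real.sq_sqrt (by norm_num)
  have hr0 : 0 < r := Real.sqrt_pos.2 (by norm_num)
  have hr1 : 1 < r := by nlinarith
  set x := f a with hx
  set y := f b with hy
  have hxy : 0 < x + y := by positivity
  let c : ℕ → ℝ := fun n => Real.cosh (n * (b - a)) / Real.sinh (n * (b - a))
  let Q : ℕ → ℝ → ℝ := fun n s => x * y * s ^ 2 - n * c n * (x + y) * s + n ^ 2
  have hQc : ∀ n, Continuous (Q n) := fun n => by simp only [Q]; fun_prop
  have hS : 0 < Real.sinh (b - a) := Real.sinh_pos_iff.2 hT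
  have hC : 0 < Real.cosh (b - a) := Real.cosh_pos _
  have hCS := Real.cosh_sq (b - a)
  have hc1 : 1 < c 1 := by
    simp only [c, Nat.cast_one, one_mul]
    rw [one_lt_div hS]
    nlinarith
  have hc2 : 2 * c 2 = c 1 + 1 / c 1 := by
    simp only [c, Nat.cast_one, one_mul, Nat.cast_ofNat]
    rw [Real.cosh_two_mul, Real.sinh_two_mul]
    field_simp
  -- The asymmetry of the boundary weights enters only through `z`, and `z ≤ 1` by the
  -- arithmetic-geometric mean inequality.
  set z := 4 * (x * y) / (x + y) ^ 2 with hz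
  have hz1 : z ≤ 1 := by
    rw [hz, div_le_one (by positivity)]
    nlinarith [sq_nonneg (x - y)]
  -- `m` separates the roots of `Q 1`: `Q 1 m = z + 1 - 2 coth L < 0`, since `z ≤ 1 < coth L`.
  set m := 2 / (x + y) with hm
  set M := 2 * r / (x + y) with hM
  have hm0 : 0 < m := by positivity
  have hmM : m < M := by rw [hm, hM]; gcongr; linarith
  have Q1m : Q 1 m < 0 := by
    have : Q 1 m = z - 2 * c 1 + 1 := by
      simp only [Q, hm, hz]; push_cast; field_simp; ring
    rw [this]; linarith
  have Q1M : Q 1 M = 3 * z + 1 - 2 * r * c 1 := by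
    simp only [Q, hM, hz, ← hr2]; push_cast; field_simp; ring
  have Q2M : Q 2 M = 3 * z - 2 * r * (c 1 + 1 / c 1) + 4 := by
    rw [← hc2]
    simp only [Q, hM, hz, ← hr2]; push_cast; field_simp; ring
  have Q0 : ∀ n : ℕ, Q n 0 = n ^ 2 := fun n => by simp [Q]
  obtain ⟨s, ⟨-, hsm⟩, hs⟩ : (0 : ℝ) ∈ Q 1 '' Set.Ioo 0 m :=
    intermediate_value_Ioo' hm0.le (hQc 1).continuousOn ⟨Q1m, by rw [Q0]; norm_num⟩
  have hsM : s ≤ M := (hsm.trans hmM).le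
  have hM0 : 0 ≤ M := (hm0.trans hmM).le
  by_cases hcase : 0 < Q 1 M
  · obtain ⟨s', ⟨hms', hs'M⟩, hs'⟩ : (0 : ℝ) ∈ Q 1 '' Set.Ioo m M :=
      intermediate_value_Ioo hmM.le (hQc 1).continuousOn ⟨Q1m, hcase⟩
    have hne : (1 : ℕ) * Real.cosh ((1 : ℕ) * (b - a)) - s * x * Real.sinh ((1 : ℕ) * (b - a)) ≠
        (1 : ℕ) * Real.cosh ((1 : ℕ) * (b - a)) - s' * x * Real.sinh ((1 : ℕ) * (b - a)) := by
      intro h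
      have h' : (s' - s) * (x * Real.sinh (b - a)) = 0 := by
        simp only [Nat.cast_one, one_mul] at h; linarith
      have : 0 < (s' - s) * (x * Real.sinh (b - a)) :=
        mul_pos (sub_pos.2 (hsm.trans hms')) (mul_pos ha hS)
      linarith
    refine ⟨_, linearIndependent_modes_one_one hne, fun i => ?_⟩
    fin_cases i
    · exact ⟨0, hM0, isDirichletToNeumann_const hab hf⟩
    · exact ⟨s, hsM, isDirichletToNeumann_of_char_eq_zero hab hf one_pos (isFourierMode_cos 1) hs⟩
    · exact ⟨s, hsM, isDirichletToNeumann_of_char_eq_zero hab hf one_pos (isFourierMode_sin 1) hs⟩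
    · exact ⟨s', hs'M.le,
        isDirichletToNeumann_of_char_eq_zero hab hf one_pos (isFourierMode_cos 1) hs'⟩
    · exact ⟨s', hs'M.le,
        isDirichletToNeumann_of_char_eq_zero hab hf one_pos (isFourierMode_sin 1) hs'⟩
  · have hQ2 : Q 2 M ≤ 0 := by
      rw [Q2M]
      exact coth_inequality hr0 hr2 (zero_lt_one.trans hc1) hz1 (by rw [← Q1M]; linarith)
    obtain ⟨s', ⟨-, hs'M⟩, hs'⟩ : (0 : ℝ) ∈ Q 2 '' Set.Icc 0 M :=
      intermediate_value_Icc' hM0 (hQc 2).continuousOn ⟨hQ2, by rw [Q0]; norm_num⟩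
    refine ⟨_, linearIndependent_modes_one_two
      ((1 : ℕ) * Real.cosh ((1 : ℕ) * (b - a)) - s * x * Real.sinh ((1 : ℕ) * (b - a)))
      ((2 : ℕ) * Real.cosh ((2 : ℕ) * (b - a)) - s' * x * Real.sinh ((2 : ℕ) * (b - a))),
      fun i => ?_⟩
    fin_cases i
    · exact ⟨0, hM0, isDirichletToNeumann_const hab hf⟩
    · exact ⟨s, hsM, isDirichletToNeumann_of_char_eq_zero hab hf one_pos (isFourierMode_cos 1) hs⟩
    · exact ⟨s, hsM, isDirichletToNeumann_of_char_eq_zero hab hf one_pos (isFourierMode_sin 1) hs⟩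
    · exact ⟨s', hs'M,
        isDirichletToNeumann_of_char_eq_zero hab hf two_pos (isFourierMode_cos 2) hs'⟩
    · exact ⟨s', hs'M,
        isDirichletToNeumann_of_char_eq_zero hab hf two_pos (isFourierMode_sin 2) hs'⟩

/-! ### Nonnegativity of eigenvalues and the bound `4π√3` -/

/-- `∫ φ e` over the circle. -/
noncomputable def circlePairing (e φ : ℝ → ℝ) : ℝ := ∫ θ in (0 : ℝ)..(2 * Real.pi), φ θ * e θ

theorem IsFourierMode.pairing_relation {a b : ℝ} (hab : a < b) {f : ℝ → ℝ}
    (hf : ∀ t ∈ Set.Icc a b, 0 < f t) {φ : BoundaryFunction} {s : ℝ}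
    (h : IsDirichletToNeumann a b (rotationalMetric f) φ (s • φ)) {n : ℕ} {e e' : ℝ → ℝ}
    (he : IsFourierMode n e e') {w w' : ℝ → ℝ} (hw : ∀ t, HasDerivAt w (w' t) t)
    (hw' : ∀ t, HasDerivAt w' ((n : ℝ) ^ 2 * w t) t) :
    (s * f b * w b - w' b) * circlePairing e φ.2 +
      (s * f a * w a + w' a) * circlePairing e φ.1 = 0 :=
  fourier_relation hab hf h hw hw' he.hasDerivAt he.hasDerivAt'
    (by simpa using he.periodic 0) (by simpa using he.periodic' 0)

theorem hasDerivAt_sinh_mode (n c t : ℝ) :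
    HasDerivAt (fun t => Real.sinh (n * (t - c))) (n * Real.cosh (n * (t - c))) t :=
  ((((hasDerivAt_id' t).sub_const c).const_mul n).sinh).congr_deriv (by ring)

theorem hasDerivAt_cosh_mode (n c t : ℝ) :
    HasDerivAt (fun t => Real.cosh (n * (t - c))) (n * Real.sinh (n * (t - c))) t :=
  ((((hasDerivAt_id' t).sub_const c).const_mul n).cosh).congr_deriv (by ring)

theorem eq_zero_of_mul_eq_mul {m α β X Y : ℝ} (hm : 0 < m) (hα : m < α) (hβ : m < β)
    (h1 : m * X = α * Y) (h2 : m * Y = β * X) : X = 0 ∧ Y = 0 := by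
  have h3 : (α * β - m ^ 2) * X = 0 := by linear_combination (-α) * h2 - m * h1
  have h4 : 0 < α * β - m ^ 2 := by nlinarith
  have hX : X = 0 := (mul_eq_zero.1 h3).resolve_left h4.ne'
  refine ⟨hX, ?_⟩
  rw [hX, mul_zero] at h2
  exact (mul_eq_zero.1 h2).resolve_left hm.ne'

/-- Testing with the solutions of `w'' = n² w` that vanish at `a` and at `b` gives two equations for
the two coefficients. For `s < 0` the diagonal entries strictly exceed the off-diagonal one (`n`, or
`1` when `n = 0`), so the system is nonsingular. -/
theorem pairing_eq_zero_of_neg {a b : ℝ} (hab : a < b) {f : ℝ → ℝ}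
    (hf : ∀ t ∈ Set.Icc a b, 0 < f t) {φ : BoundaryFunction} {s : ℝ} (hs : s < 0)
    (h : IsDirichletToNeumann a b (rotationalMetric f) φ (s • φ)) {n : ℕ} {e e' : ℝ → ℝ}
    (he : IsFourierMode n e e') : circlePairing e φ.1 = 0 ∧ circlePairing e φ.2 = 0 := by
  have ha := hf a (Set.left_mem_Icc.2 hab.le)
  have hb := hf b (Set.right_mem_Icc.2 hab.le)
  have hT : 0 < b - a := sub_pos.2 hab
  rcases Nat.eq_zero_or_pos n with rfl | hn
  · have d : ∀ c t : ℝ, HasDerivAt (fun t => t - c) 1 t := fun c t => (hasDerivAt_id' t).sub_const c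
    have d' : ∀ c t : ℝ, HasDerivAt (fun _ : ℝ => (1 : ℝ)) (((0 : ℕ) : ℝ) ^ 2 * (t - c)) t :=
      fun c t => by simpa using hasDerivAt_const t (1 : ℝ)
    have r1 := he.pairing_relation hab hf h (d a) (d' a)
    have r2 := he.pairing_relation hab hf h (d b) (d' b)
    refine eq_zero_of_mul_eq_mul one_pos (α := 1 - s * f b * (b - a))
      (β := 1 - s * f a * (b - a)) ?_ ?_ ?_ ?_
    · have := mul_pos (mul_pos (neg_pos.2 hs) hb) hT; linarith
    · have := mul_pos (mul_pos (neg_pos.2 hs) ha) hT; linarith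
    · linear_combination r1
    · linear_combination -r2
  · have hn' : (0 : ℝ) < n := by exact_mod_cast hn
    have d' : ∀ c t : ℝ, HasDerivAt (fun t => (n : ℝ) * Real.cosh (n * (t - c)))
        ((n : ℝ) ^ 2 * Real.sinh (n * (t - c))) t := fun c t =>
      ((hasDerivAt_cosh_mode n c t).const_mul (n : ℝ)).congr_deriv (by ring)
    have r1 := he.pairing_relation hab hf h (hasDerivAt_sinh_mode n a) (d' a)
    have r2 := he.pairing_relation hab hf h (hasDerivAt_sinh_mode n b) (d' b)
    have hS : 0 < Real.sinh (n * (b - a)) := Real.sinh_pos_iff.2 (mul_pos hn' hT)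
    have hC : 1 < Real.cosh (n * (b - a)) := Real.one_lt_cosh.2 (mul_pos hn' hT).ne'
    rw [show (n : ℝ) * (a - b) = -(n * (b - a)) by ring] at r2
    simp only [sub_self, mul_zero, Real.sinh_zero, Real.cosh_zero, Real.sinh_neg,
      Real.cosh_neg] at r1 r2
    refine eq_zero_of_mul_eq_mul hn'
      (α := n * Real.cosh (n * (b - a)) - s * f b * Real.sinh (n * (b - a)))
      (β := n * Real.cosh (n * (b - a)) - s * f a * Real.sinh (n * (b - a))) ?_ ?_ ?_ ?_
    · have := mul_pos (mul_pos (neg_pos.2 hs) hb) hS; nlinarith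
    · have := mul_pos (mul_pos (neg_pos.2 hs) ha) hS; nlinarith
    · linear_combination r1
    · linear_combination -r2

theorem eigenvalue_nonneg {a b : ℝ} (hab : a < b) {f : ℝ → ℝ}
    (hf : ∀ t ∈ Set.Icc a b, 0 < f t) {φ : BoundaryFunction} (hφ : φ ≠ 0) {s : ℝ}
    (h : IsDirichletToNeumann a b (rotationalMetric f) φ (s • φ)) : 0 ≤ s := by
  by_contra! hs
  obtain ⟨u, hu, -, -⟩ := id h
  refine hφ (Prod.ext ?_ ?_)
  · exact eq_zero_of_fourier_coeff_eq_zero (hu.continuous_left hab) (hu.periodic_left hab)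
      (fun n => (pairing_eq_zero_of_neg hab hf hs h (isFourierMode_cos n)).1)
      (fun n => (pairing_eq_zero_of_neg hab hf hs h (isFourierMode_sin n)).1)
  · exact eq_zero_of_fourier_coeff_eq_zero (hu.continuous_right hab) (hu.periodic_right hab)
      (fun n => (pairing_eq_zero_of_neg hab hf hs h (isFourierMode_cos n)).2)
      (fun n => (pairing_eq_zero_of_neg hab hf hs h (isFourierMode_sin n)).2)

theorem steklovEigenvalue_four_le {a b : ℝ} (hab : a < b) {f : ℝ → ℝ}
    (hf : ∀ t ∈ Set.Icc a b, 0 < f t) :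
    steklovEigenvalue a b (rotationalMetric f) 4 ≤ 2 * Real.sqrt 3 / (f a + f b) := by
  -- The infimum is meaningful only for a set bounded below; nonnegativity of eigenvalues supplies
  -- the bound.
  refine csInf_le ⟨0, ?_⟩ (exists_five_eigenfunctions hab hf)
  rintro σ ⟨φ, hφ, h⟩
  obtain ⟨s, hs, h⟩ := h 0
  exact (eigenvalue_nonneg hab hf (hφ.ne_zero 0) h).trans hs

theorem normalizedSteklovEigenvalue_four_le {a b : ℝ} (hab : a < b) {f : ℝ → ℝ}
    (hf : ∀ t ∈ Set.Icc a b, 0 < f t) :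
    normalizedSteklovEigenvalue a b (rotationalMetric f) 4 ≤ 4 * Real.pi * Real.sqrt 3 := by
  have ha := hf a (Set.left_mem_Icc.2 hab.le)
  have hb := hf b (Set.right_mem_Icc.2 hab.le)
  rw [normalizedSteklovEigenvalue, boundaryLength_rotationalMetric ha hb]
  calc _ ≤ 2 * Real.sqrt 3 / (f a + f b) * (2 * Real.pi * (f a + f b)) := by
        gcongr
        exact steklovEigenvalue_four_le hab hf
    _ = 4 * Real.pi * Real.sqrt 3 := by field_simp; ring

/-! ### Equality on the critical symmetric cylinder -/

/-- The odd branch `n coth(n h)` stays at or above `√3`: equality at `n = 1`, and `√3 ≤ 2 ≤ n` with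
`sinh < cosh` afterwards. -/
theorem sqrt_three_mul_sinh_le {h : ℝ} (hh : 0 < h) (hc : Real.cosh (2 * h) = 2) {n : ℕ}
    (hn : 1 ≤ n) : Real.sqrt 3 * Real.sinh (n * h) ≤ n * Real.cosh (n * h) := by
  have hr2 : Real.sqrt 3 ^ 2 = 3 := Real.sq_sqrt (by norm_num)
  have hr0 : 0 < Real.sqrt 3 := Real.sqrt_pos.2 (by norm_num)
  rcases hn.eq_or_lt with rfl | hn
  · simp only [Nat.cast_one, one_mul]
    have h1 := Real.cosh_sq h
    have h2 := Real.cosh_two_mul h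
    refine (sq_le_sq₀ (mul_pos hr0 (Real.sinh_pos_iff.2 hh)).le (Real.cosh_pos h).le).1 ?_
    rw [mul_pow, hr2]; linarith
  · have hn' : (2 : ℝ) ≤ n := by exact_mod_cast hn
    have hr : Real.sqrt 3 ≤ 2 := by nlinarith
    have h1 : 0 < Real.sinh (n * h) := Real.sinh_pos_iff.2 (by positivity)
    have h2 := Real.sinh_lt_cosh (n * h)
    exact mul_le_mul (hr.trans hn') h2.le h1.le (by positivity)

/-- The even branch `n tanh(n h)` stays at or above `√3` from `n = 2` on: since `sinh 2h = √3`,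
expanding `sinh(n h - 2h) ≥ 0` gives `√3 cosh(n h) ≤ 2 sinh(n h)`. -/
theorem sqrt_three_mul_cosh_le {h : ℝ} (hh : 0 < h) (hc : Real.cosh (2 * h) = 2) {n : ℕ}
    (hn : 2 ≤ n) : Real.sqrt 3 * Real.cosh (n * h) ≤ n * Real.sinh (n * h) := by
  have hn' : (2 : ℝ) ≤ n := by exact_mod_cast hn
  have hs : Real.sinh (2 * h) = Real.sqrt 3 := by
    have h1 := Real.cosh_sq (2 * h)
    have h2 : 0 < Real.sinh (2 * h) := Real.sinh_pos_iff.2 (by positivity)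
    rw [eq_comm, Real.sqrt_eq_iff_mul_self_eq_of_pos h2]
    rw [hc] at h1; linarith
  have h1 : 0 ≤ Real.sinh (n * h - 2 * h) := Real.sinh_nonneg_iff.2 (by nlinarith)
  rw [Real.sinh_sub, hc, hs] at h1
  have h2 : 0 < Real.sinh (n * h) := Real.sinh_pos_iff.2 (by positivity)
  nlinarith

/-- The even test function `cosh(n t)` isolates the even part of the block, whose eigenvalue is too
large for `s`. -/
theorem pairing_antisymmetric {h : ℝ} (hh : 0 < h) {f : ℝ → ℝ}
    (hf : ∀ t ∈ Set.Icc (-h) h, 0 < f t) (hsymm : f (-h) = f h) (hc : Real.cosh (2 * h) = 2)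
    {φ : BoundaryFunction} {s : ℝ} (hs : s * f h < Real.sqrt 3)
    (hφ : IsDirichletToNeumann (-h) h (rotationalMetric f) φ (s • φ)) {n : ℕ} (hn : 2 ≤ n)
    {e e' : ℝ → ℝ} (he : IsFourierMode n e e') :
    circlePairing e φ.1 + circlePairing e φ.2 = 0 := by
  have d' : ∀ c t : ℝ, HasDerivAt (fun t => (n : ℝ) * Real.sinh (n * (t - c)))
      ((n : ℝ) ^ 2 * Real.cosh (n * (t - c))) t := fun c t =>
    ((hasDerivAt_sinh_mode n c t).const_mul (n : ℝ)).congr_deriv (by ring)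
  have r := he.pairing_relation (by linarith) hf hφ (hasDerivAt_cosh_mode n 0) (d' 0)
  simp only [sub_zero, mul_neg, Real.cosh_neg, Real.sinh_neg, hsymm] at r
  have h1 := sqrt_three_mul_cosh_le hh hc hn
  have h2 := mul_lt_mul_of_pos_right hs (Real.cosh_pos (n * h))
  have h3 : (n * Real.sinh (n * h) - s * f h * Real.cosh (n * h)) *
      (circlePairing e φ.1 + circlePairing e φ.2) = 0 := by linear_combination -r
  exact (mul_eq_zero.1 h3).resolve_left (by linarith : (0 : ℝ) < _).ne'

/-- The odd test function `sinh(n t)` isolates the odd part of the block, already too large at `n =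
1`. -/
theorem pairing_symmetric {h : ℝ} (hh : 0 < h) {f : ℝ → ℝ}
    (hf : ∀ t ∈ Set.Icc (-h) h, 0 < f t) (hsymm : f (-h) = f h) (hc : Real.cosh (2 * h) = 2)
    {φ : BoundaryFunction} {s : ℝ} (hs : s * f h < Real.sqrt 3)
    (hφ : IsDirichletToNeumann (-h) h (rotationalMetric f) φ (s • φ)) {n : ℕ} (hn : 1 ≤ n)
    {e e' : ℝ → ℝ} (he : IsFourierMode n e e') :
    circlePairing e φ.1 = circlePairing e φ.2 := by
  have d' : ∀ c t : ℝ, HasDerivAt (fun t => (n : ℝ) * Real.cosh (n * (t - c)))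
      ((n : ℝ) ^ 2 * Real.sinh (n * (t - c))) t := fun c t =>
    ((hasDerivAt_cosh_mode n c t).const_mul (n : ℝ)).congr_deriv (by ring)
  have r := he.pairing_relation (by linarith) hf hφ (hasDerivAt_sinh_mode n 0) (d' 0)
  simp only [sub_zero, mul_neg, Real.cosh_neg, Real.sinh_neg, hsymm] at r
  have hn' : (0 : ℝ) < n := by exact_mod_cast hn
  have h1 := sqrt_three_mul_sinh_le hh hc hn
  have h2 := mul_lt_mul_of_pos_right hs (Real.sinh_pos_iff.2 (mul_pos hn' hh))
  have h3 : (n * Real.cosh (n * h) - s * f h * Real.sinh (n * h)) *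
      (circlePairing e φ.1 - circlePairing e φ.2) = 0 := by linear_combination r
  exact sub_eq_zero.1 ((mul_eq_zero.1 h3).resolve_left (by linarith : (0 : ℝ) < _).ne')

theorem circlePairing_sum {ι : Type*} [Fintype ι] {e : ℝ → ℝ} (he : Continuous e)
    {φ : ι → ℝ → ℝ} (hφ : ∀ i, Continuous (φ i)) (c : ι → ℝ) :
    circlePairing e (∑ i, c i • φ i) = ∑ i, c i * circlePairing e (φ i) := by
  simp only [circlePairing, Finset.sum_apply, Pi.smul_apply, smul_eq_mul, Finset.sum_mul, mul_assoc]
  rw [intervalIntegral.integral_finsetSum]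
  · simp only [intervalIntegral.integral_const_mul]
  · intro i _
    have := hφ i
    exact Continuous.intervalIntegrable (by fun_prop) _ _

/-- The eigenfunctions with eigenvalues below `√3 / f(h)` on the critical symmetric cylinder span a
space of dimension at most four. -/
theorem not_linearIndependent_of_lt {h : ℝ} (hh : 0 < h) {f : ℝ → ℝ}
    (hf : ∀ t ∈ Set.Icc (-h) h, 0 < f t) (hsymm : f (-h) = f h) (hc : Real.cosh (2 * h) = 2)
    {φ : Fin 5 → BoundaryFunction} {s : Fin 5 → ℝ} (hs : ∀ i, s i * f h < Real.sqrt 3)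
    (hφ : ∀ i, IsDirichletToNeumann (-h) h (rotationalMetric f) (φ i) (s i • φ i)) :
    ¬ LinearIndependent ℝ φ := by
  intro hli
  have hab : -h < h := by linarith
  choose u hu _ _ using id hφ
  have c1 : ∀ i, Continuous (φ i).1 := fun i => (hu i).continuous_left hab
  have c2 : ∀ i, Continuous (φ i).2 := fun i => (hu i).continuous_right hab
  let E : ℕ → ℝ → ℝ := fun n θ => Real.cos (n * θ)
  let O : ℕ → ℝ → ℝ := fun n θ => Real.sin (n * θ)
  -- These four functionals are all that parity leaves free: both means, and the even cosine and
  -- sine coefficients at `n = 1`. A combination killed by them has no Fourier coefficients at all.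
  let N : Matrix (Fin 4) (Fin 5) ℝ := Matrix.of ![fun i => circlePairing (E 0) (φ i).1,
    fun i => circlePairing (E 0) (φ i).2,
    fun i => circlePairing (E 1) (φ i).1 + circlePairing (E 1) (φ i).2,
    fun i => circlePairing (O 1) (φ i).1 + circlePairing (O 1) (φ i).2]
  obtain ⟨c, hcN, hc0⟩ := (Submodule.ne_bot_iff _).1
    (LinearMap.ker_ne_bot_of_finrank_lt (f := Matrix.mulVecLin N) (by simp))
  rw [LinearMap.mem_ker, Matrix.mulVecLin_apply] at hcN
  have hker : ∀ j, ∑ i, N j i * c i = 0 := fun j => congrFun hcN j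
  have hsum : ∀ (A : Fin 5 → ℝ), (∑ i, A i * c i = 0) → ∑ i, c i * A i = 0 := fun A hA => by
    simpa [mul_comm] using hA
  have k0 := hsum _ (hker 0)
  have k1 := hsum _ (hker 1)
  have k2 := hsum _ (hker 2)
  have k3 := hsum _ (hker 3)
  simp only [N, Matrix.of_apply, Matrix.cons_val] at k0 k1 k2 k3
  set ψ₁ : ℝ → ℝ := ∑ i, c i • (φ i).1 with hψ₁
  set ψ₂ : ℝ → ℝ := ∑ i, c i • (φ i).2 with hψ₂
  have hpair : ∀ (n : ℕ) (e e' : ℝ → ℝ), IsFourierMode n e e' →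
      (n = 0 → ∑ i, c i * circlePairing e (φ i).1 = 0 ∧ ∑ i, c i * circlePairing e (φ i).2 = 0) →
      (n = 1 → ∑ i, c i * (circlePairing e (φ i).1 + circlePairing e (φ i).2) = 0) →
      circlePairing e ψ₁ = 0 ∧ circlePairing e ψ₂ = 0 := by
    intro n e e' he h0 h1
    rw [circlePairing_sum he.smooth.continuous c1, circlePairing_sum he.smooth.continuous c2]
    rcases Nat.eq_zero_or_pos n with hn | hn
    · exact h0 hn
    · have hsym : ∀ i, circlePairing e (φ i).1 = circlePairing e (φ i).2 := fun i =>
        pairing_symmetric hh hf hsymm hc (hs i) (hφ i) hn he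
      have hplus : ∑ i, c i * (circlePairing e (φ i).1 + circlePairing e (φ i).2) = 0 := by
        rcases (Nat.succ_le_of_lt hn).eq_or_lt with h | h
        · exact h1 h.symm
        · simp [fun i => pairing_antisymmetric hh hf hsymm hc (hs i) (hφ i) h he]
      simp only [hsym, ← two_mul, mul_left_comm _ (2 : ℝ), ← Finset.mul_sum] at hplus ⊢
      have := (mul_eq_zero.1 hplus).resolve_left two_ne_zero
      exact ⟨this, this⟩
  have hE : ∀ n, circlePairing (E n) ψ₁ = 0 ∧ circlePairing (E n) ψ₂ = 0 := fun n =>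
    hpair n _ _ (isFourierMode_cos n) (by rintro rfl; exact ⟨k0, k1⟩) (by rintro rfl; exact k2)
  have hO : ∀ n, circlePairing (O n) ψ₁ = 0 ∧ circlePairing (O n) ψ₂ = 0 := fun n =>
    hpair n _ _ (isFourierMode_sin n) (by rintro rfl; simp [circlePairing, O])
      (by rintro rfl; exact k3)
  have z1 : ψ₁ = 0 := eq_zero_of_fourier_coeff_eq_zero
    (by rw [hψ₁, Finset.sum_fn]; exact continuous_finsetSum _ fun i _ => (c1 i).const_smul (c i))
    (fun θ => by simp [hψ₁, fun i => (hu i).periodic_left hab θ])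
    (fun n => (hE n).1) (fun n => (hO n).1)
  have z2 : ψ₂ = 0 := eq_zero_of_fourier_coeff_eq_zero
    (by rw [hψ₂, Finset.sum_fn]; exact continuous_finsetSum _ fun i _ => (c2 i).const_smul (c i))
    (fun θ => by simp [hψ₂, fun i => (hu i).periodic_right hab θ])
    (fun n => (hE n).2) (fun n => (hO n).2)
  refine hc0 (funext (Fintype.linearIndependent_iff.1 hli c (Prod.ext ?_ ?_)))
  · rw [Prod.fst_sum]; exact z1
  · rw [Prod.snd_sum]; exact z2

theorem normalizedSteklovEigenvalue_four_critical {h : ℝ} (hh : 0 < h) {f : ℝ → ℝ}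
    (hf : ∀ t ∈ Set.Icc (-h) h, 0 < f t) (hsymm : f (-h) = f h) (hc : Real.cosh (2 * h) = 2) :
    normalizedSteklovEigenvalue (-h) h (rotationalMetric f) 4 = 4 * Real.pi * Real.sqrt 3 := by
  have hab : -h < h := by linarith
  have hF := hf h (Set.right_mem_Icc.2 hab.le)
  refine le_antisymm (normalizedSteklovEigenvalue_four_le hab hf) ?_
  have key : Real.sqrt 3 / f h ≤ steklovEigenvalue (-h) h (rotationalMetric f) 4 := by
    refine le_csInf ⟨_, exists_five_eigenfunctions hab hf⟩ ?_
    rintro σ ⟨φ, hφ, hσ⟩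
    by_contra! hlt
    choose s hs hD using hσ
    exact not_linearIndependent_of_lt hh hf hsymm hc
      (fun i => (lt_div_iff₀ hF).1 ((hs i).trans_lt hlt)) hD hφ
  rw [normalizedSteklovEigenvalue, boundaryLength_rotationalMetric (by rw [hsymm]; exact hF) hF,
    hsymm]
  calc 4 * Real.pi * Real.sqrt 3 = Real.sqrt 3 / f h * (2 * Real.pi * (f h + f h)) := by
        field_simp; ring
    _ ≤ _ := by gcongr

end Steklov

/-! ### The main theorem -/

/-- There is a number `T = T_{2,1}(1)`, the unique positive root of `2 tanh s = coth (s / 2)`, such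
that the part `|t| ≤ T / 2` of the Möbius band, the critical Möbius band, is the symmetric part that
meets a sphere around the origin orthogonally along its boundary, and the metric that it induces on
the cylinder is rotationally symmetric and maximizes the normalized fourth Steklov eigenvalue among
all rotationally symmetric metrics on cylinders. -/
theorem mainTheorem3 :
    ∃ T : ℝ, Steklov.IsUniqueCrossing 2 T ∧
      (∀ s t θ η : ℝ, Steklov.moebius (s, θ) = Steklov.moebius (t, η) ↔
        (s = t ∧ ∃ n : ℤ, θ = η + 2 * Real.pi * n) ∨
          (s = -t ∧ ∃ n : ℤ, θ = η + Real.pi + 2 * Real.pi * n)) ∧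
      (∀ s : ℝ, 0 < s → (Steklov.MeetsSphereOrthogonally (-s) s Steklov.moebius ↔ s = T / 2)) ∧
      (∃ f : ℝ → ℝ, Steklov.IsConformalFactor (-(T / 2)) (T / 2) f ∧
        ∀ t ∈ Set.Icc (-(T / 2)) (T / 2), ∀ θ : ℝ,
          Steklov.inducedMetric Steklov.moebius (t, θ) = Steklov.rotationalMetric f (t, θ)) ∧
      IsGreatest
        {m : ℝ | ∃ (a b : ℝ) (f : ℝ → ℝ), a < b ∧ Steklov.IsConformalFactor a b f ∧
          m = Steklov.normalizedSteklovEigenvalue a b (Steklov.rotationalMetric f) 4}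
        (Steklov.normalizedSteklovEigenvalue (-(T / 2)) (T / 2)
          (Steklov.inducedMetric Steklov.moebius) 4) := by
  obtain ⟨T, hT, hc⟩ := Steklov.exists_cosh_eq_two
  have hT2 : 0 < T / 2 := by positivity
  have hfac := fun a b : ℝ => Steklov.isConformalFactor_moebiusFactor a b
  refine ⟨T, Steklov.isUniqueCrossing_of_cosh_eq_two hT hc, Steklov.moebius_eq_iff,
    fun s hs => ?_, ⟨Steklov.moebiusFactor, hfac _ _, fun t _ θ => Steklov.inducedMetric_moebius _⟩,
    ?_⟩
  · rw [Steklov.meetsSphereOrthogonally_moebius_iff hs]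
    constructor
    · intro h
      have := Steklov.eq_of_cosh_eq (by positivity) hT (h.trans hc.symm)
      linarith
    · rintro rfl
      rw [mul_div_cancel₀ T two_ne_zero, hc]
  · rw [show Steklov.inducedMetric Steklov.moebius =
      Steklov.rotationalMetric Steklov.moebiusFactor from funext Steklov.inducedMetric_moebius]
    refine ⟨⟨_, _, _, by linarith, hfac _ _, rfl⟩, ?_⟩
    rintro _ ⟨a, b, f, hab, hf, rfl⟩
    rw [Steklov.normalizedSteklovEigenvalue_four_critical hT2 (hfac _ _).2
      (Steklov.moebiusFactor_neg _) (by rw [mul_div_cancel₀ T two_ne_zero, hc])]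
    exact Steklov.normalizedSteklovEigenvalue_four_le hab hf.2
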